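/- **Setting.** Let $e\in(0,1)$, $b=\sqrt{1-e^2}$, let $D\subset\mathbb R^2$ be the open region bounded by the ellipse $\partial D=\{\gamma(\xi)=(\cos\xi,\,b\sin\xi)\}$ of eccentricity $e$ (semimajor axis $1$, centred at the origin), and let $t(\xi)$ and $n(\xi)$ be its unit tangent and outward unit normal vectors. For $\mathcal E,h,\mu,\omega>0$ put $V_I(z)=\mathcal E+h+\mu/|z|$ and $V_E(z)=\mathcal E-\frac{\omega^2}{2}|z|^2$. A point particle moves with zero total energy: in $D$ it satisfies $z''=-\mu z/|z|^3$, $\frac12|z'|^2=V_I(z)$ (with complete reflection after a collision with the origin), and outside $\overline D$ it satisfies $z''=-\omega^2 z$, $\frac12|z'|^2=V_E(z)$. When it crosses $\partial D$ at a point $\bar z$ with tangent unit vector $t$, the outer velocity $v_E$ and the inner velocity $v_I$ obey Snell's law $\sqrt{V_E(\bar z)}\,\frac{v_E}{|v_E|}\cdot t=\sqrt{V_I(\bar z)}\,\frac{v_I}{|v_I|}\cdot t$. The first return map $F$ is the partially defined map $(\xi_0,\alpha_0)\mapsto(\xi_1,\alpha_1)$ on $[0,2\pi)\times[-\frac\pi2,\frac\pi2]$: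 start at $\gamma(\xi_0)$ with the outward velocity $\sqrt{2V_E(\gamma(\xi_0))}\,(\cos\alpha_0\,n(\xi_0)+\sin\alpha_0\,t(\xi_0))$, follow the outer arc until it first returns to $\partial D$, refract into $D$, follow the inner arc until it first returns to $\partial D$, and refract outwards; the resulting point and velocity are encoded by $(\xi_1,\alpha_1)$. A *nontrivial free-fall brake orbit of period two* is a set $\{x,y\}$ with $x\ne y$, $F(x)=y$, $F(y)=x$, such that at both points the outward velocity is a positive multiple of the position vector $\gamma(\xi)$ (so that the outer arcs are homothetic), and such that neither point is homothetic (a point $(\xi,\alpha)$ being homothetic if $\gamma(\xi)\perp\gamma'(\xi)$ and $\alpha=0$). **Theorem.** Let $\mathcal E>0$, $\omega>0$ with $2\mathcal E>\omega^2$, and let $e\in(0,1/\sqrt2)$. Put $$\bar\mu=\bar\mu(\mathcal E,\omega,e)=\frac{e^2(1-e^2)^{3/2}(2\mathcal E-e^2\omega^2)}{(2e^2-1)^2}.$$ Then $\bar\mu>0$, and for every $\mu>\bar\mu$ there is $\bar h=\bar h(\mathcal E,\omega,e,\mu)>0$ such that for every $h>\bar h$ there are at least four (distinct) nontrivial free-fall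 brake orbits of period two. -/

import Mathlib

open Set

noncomputable section

/-- The constants of the model: the energy `E`, the energy jump `h`, the mass `μ` of the Keplerian
centre, the frequency `ω` of the oscillator, and the eccentricity `e` of the elliptic interface. -/
structure GalaxyParams where
  E : ℝ
  h : ℝ
  μ : ℝ
  ω : ℝ
  e : ℝ

namespace GalaxyParams

variable (P : GalaxyParams)

/-- Semiminor axis of the ellipse with semimajor axis `1` and eccentricity `e`. -/
def b : ℝ := √(1 - P.e ^ 2)

/-- The plane is identified with `ℂ`; `γ(ξ) = (cos ξ, b sin ξ)` parametrises the interface. -/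
def γ (ξ : ℝ) : ℂ := ⟨Real.cos ξ, P.b * Real.sin ξ⟩

/-- The derivative of `γ`. -/
def γ' (ξ : ℝ) : ℂ := ⟨-Real.sin ξ, P.b * Real.cos ξ⟩

/-- Unit tangent vector to the interface at `γ(ξ)`. -/
def tangent (ξ : ℝ) : ℂ := ((‖P.γ' ξ‖⁻¹ : ℝ) : ℂ) * P.γ' ξ

/-- Outward unit normal vector to the interface at `γ(ξ)`: the tangent rotated by `-π/2`. -/
def normal (ξ : ℝ) : ℂ := -Complex.I * P.tangent ξ

/-- The open domain `D` bounded by the ellipse. -/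
def D : Set ℂ := {z | z.re ^ 2 + z.im ^ 2 / P.b ^ 2 < 1}

/-- Inner (Keplerian) potential. -/
def VI (z : ℂ) : ℝ := P.E + P.h + P.μ / ‖z‖

/-- Outer (harmonic) potential. -/
def VE (z : ℂ) : ℝ := P.E - P.ω ^ 2 / 2 * ‖z‖ ^ 2

/-- `z`, with velocity `u`, is an outer arc of duration `T`: a zero-energy solution of
`z'' = -ω² z` that stays outside the closure of `D` at all intermediate times. -/
structure IsOuterArc (z u : ℝ → ℂ) (T : ℝ) : Prop where
  pos : 0 < T
  deriv_z : ∀ s ∈ Icc 0 T, HasDerivWithinAt z (u s) (Icc 0 T) s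
  deriv_u : ∀ s ∈ Icc 0 T, HasDerivWithinAt u (-(P.ω : ℂ) ^ 2 * z s) (Icc 0 T) s
  energy : ∀ s ∈ Icc 0 T, ‖u s‖ ^ 2 / 2 - P.VE (z s) = 0
  outside : ∀ s ∈ Ioo 0 T, z s ∉ closure P.D

/-- `z`, with velocity `u`, is an inner arc of duration `S`: a continuous path lying in `D` at all
intermediate times which, away from the origin, is a zero-energy solution of `z'' = -μ z / |z|³`,
and which is completely reflected at a collision with the origin (the motion after the collision is
the time reversal of the motion before it). -/
structure IsInnerArc (z u : ℝ → ℂ) (S : ℝ) : Prop where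
  pos : 0 < S
  cont : ContinuousOn z (Icc 0 S)
  deriv_z : ∀ s ∈ Icc 0 S, z s ≠ 0 → HasDerivWithinAt z (u s) (Icc 0 S) s
  deriv_u : ∀ s ∈ Icc 0 S, z s ≠ 0 →
    HasDerivWithinAt u (-((P.μ / ‖z s‖ ^ 3 : ℝ) : ℂ) * z s) (Icc 0 S) s
  energy : ∀ s ∈ Icc 0 S, z s ≠ 0 → ‖u s‖ ^ 2 / 2 - P.VI (z s) = 0
  collision : ∀ τ ∈ Icc 0 S, z τ = 0 →
    ∀ s, τ - s ∈ Icc 0 S → τ + s ∈ Icc 0 S → z (τ + s) = z (τ - s)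
  inside : ∀ s ∈ Ioo 0 S, z s ∈ P.D

/-- Snell's refraction law at `γ(ξ)`, for the outer velocity `v` and the inner velocity `w`:
`√V_E (v/|v|) · e = √V_I (w/|w|) · e` with `e` the unit tangent vector. -/
def Snell (ξ : ℝ) (v w : ℂ) : Prop :=
  √(P.VE (P.γ ξ)) * (inner ℝ v (P.tangent ξ) / ‖v‖) =
    √(P.VI (P.γ ξ)) * (inner ℝ w (P.tangent ξ) / ‖w‖)

/-- The phase space of pairs `(ξ, α)`: a point `γ(ξ)` of the interface (each point being counted
once) and the angle `α` of an outward velocity with the outer normal. -/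
def phaseSpace : Set (ℝ × ℝ) :=
  Ico 0 (2 * Real.pi) ×ˢ Icc (-(Real.pi / 2)) (Real.pi / 2)

/-- The outward velocity, of zero total energy, encoded by `(ξ, α)`:
`√(2 V_E(γ(ξ))) (cos α n(ξ) + sin α t(ξ))`. -/
def vel (x : ℝ × ℝ) : ℂ :=
  ((√(2 * P.VE (P.γ x.1)) : ℝ) : ℂ) *
    ((Real.cos x.2 : ℂ) * P.normal x.1 + (Real.sin x.2 : ℂ) * P.tangent x.1)

/-- The graph of the first return map `F`: `F` is defined at `x = (ξ₀, α₀)` with `F(x) = y` when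
the outer arc that starts with the data `x` first comes back to the interface at some `γ(η)`,
is refracted there into an inward inner arc, and this inner arc first comes back to the interface
at `γ(ξ₁)`, where it is refracted into the outward outer velocity encoded by `y = (ξ₁, α₁)`. -/
def FirstReturn (x y : ℝ × ℝ) : Prop :=
  x ∈ phaseSpace ∧ y ∈ phaseSpace ∧
  ∃ (zE uE zI uI : ℝ → ℂ) (T S η : ℝ),
    P.IsOuterArc zE uE T ∧ zE 0 = P.γ x.1 ∧ uE 0 = P.vel x ∧ zE T = P.γ η ∧
    P.Snell η (uE T) (uI 0) ∧ inner ℝ (uI 0) (P.normal η) < 0 ∧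
    P.IsInnerArc zI uI S ∧ zI 0 = P.γ η ∧ zI S = P.γ y.1 ∧
    P.Snell y.1 (P.vel y) (uI S)

/-- The outer arc starting with the data `x` is homothetic (a free-fall arc): its initial velocity
is the outward radial vector of zero energy. -/
def IsRadial (x : ℝ × ℝ) : Prop :=
  P.vel x = ((√(2 * P.VE (P.γ x.1)) / ‖P.γ x.1‖ : ℝ) : ℂ) * P.γ x.1

/-- `x` generates a homothetic orbit of the system: `γ(ξ) ⊥ γ'(ξ)` and `α = 0`. -/
def IsHomothetic (x : ℝ × ℝ) : Prop :=
  inner ℝ (P.γ x.1) (P.γ' x.1) = 0 ∧ x.2 = 0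

/-- `O = {x, y}` is a nontrivial (non-homothetic) free-fall brake orbit of minimal period two of
the first return map. -/
def IsTwoPeriodicBrakeOrbit (O : Set (ℝ × ℝ)) : Prop :=
  ∃ x y : ℝ × ℝ, O = {x, y} ∧ x ≠ y ∧
    P.FirstReturn x y ∧ P.FirstReturn y x ∧
    P.IsRadial x ∧ P.IsRadial y ∧
    ¬ P.IsHomothetic x ∧ ¬ P.IsHomothetic y

end GalaxyParams

/-- The threshold for `μ`:
`e² (1 - e²)^{3/2} (2E - e² ω²) / (2e² - 1)²`. -/
def muBar (E ω e : ℝ) : ℝ :=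
  e ^ 2 * √(1 - e ^ 2) ^ 3 * (2 * E - e ^ 2 * ω ^ 2) / (2 * e ^ 2 - 1) ^ 2

end

/-! A radial outer velocity produces a free fall: the particle rises, stops and returns along the
same segment with reversed velocity. A brake orbit of period two therefore amounts to a single
Keplerian arc between two points of the ellipse that refracts into the radial direction at both
ends; the way back is its time reversal.

Put z = ζ² with dt proportional to |ζ|² ds (Levi-Civita). A Keplerian arc of energy E + h becomes a
solution of ζ'' = ζ, determined by its ends A, B and by η = 1 / sinh σ, where σ is its duration in
s. Since speeds equal √(2V), Snell's law says that the tangential velocity is continuous. What is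
needed is thus one energy equation and two tangential equations, collected in `IsLink`. The arc does
not leave the ellipse too early because the quadratic form of the ellipse is strictly convex along
ζ² when e² ≤ 1/2 (`hypArc_sq_mem_D`).

For large h a link is found by perturbation. With ε² = 1/(E + h), the ends are sought at distance of
order ε² from the vertices (1, 0) and (0, b), and η = ε² k. The rescaled equations (`linkMap`)
extend in a C¹ way to ε = 0, where they are affine and triangular in the remaining unknowns (k, X,
Y), with an explicit root having X > 0 > Y. A surjective derivative makes the map locally open, so a
root persists for every small ε (`eventually_exists_linkMap_eq`). The signs of X and Y keep the ends
off the vertices, so the orbit is not homothetic, and the symmetry group of the ellipse, of order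
four, turns it into four orbits. -/

open Filter Topology

noncomputable section

/-! ### Outer arcs: radial harmonic motion. -/

namespace GalaxyParams

variable (P : GalaxyParams)

/-- The quadratic form defining the ellipse. -/
def ellipseForm (z : ℂ) : ℝ := z.re ^ 2 + z.im ^ 2 / P.b ^ 2

lemma ellipseForm_real_mul (ρ : ℝ) (z : ℂ) :
    P.ellipseForm ((ρ : ℂ) * z) = ρ ^ 2 * P.ellipseForm z := by
  simp [ellipseForm]; ring

lemma ellipseForm_γ (hb : 0 < P.b) (ξ : ℝ) : P.ellipseForm (P.γ ξ) = 1 := by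
  have := Real.cos_sq_add_sin_sq ξ
  simp only [ellipseForm, γ]
  rw [mul_pow, mul_div_cancel_left₀ _ (by positivity), this]

lemma ellipseForm_le_one_of_mem_closure {z : ℂ} (hz : z ∈ closure P.D) : P.ellipseForm z ≤ 1 := by
  have hc : IsClosed {z : ℂ | P.ellipseForm z ≤ 1} := by
    refine isClosed_le ?_ continuous_const
    unfold ellipseForm
    fun_prop
  exact closure_minimal (fun w (hw : P.ellipseForm w < 1) => hw.le) hc hz

/-- Radial motion is one-dimensional: the position is p times cos(ωs - φ) / cos φ, symmetric about
the braking time φ / ω, and this factor exceeds 1 strictly between the two passages through p. -/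
lemma exists_outerArc (hω : 0 < P.ω) {p : ℂ} (hp : P.ellipseForm p = 1) (hV : 0 < P.VE p) :
    ∃ (z u : ℝ → ℂ) (T : ℝ), P.IsOuterArc z u T ∧ z 0 = p ∧
      u 0 = ((√(2 * P.VE p) / ‖p‖ : ℝ) : ℂ) * p ∧ z T = p ∧
      u T = ((-(√(2 * P.VE p) / ‖p‖) : ℝ) : ℂ) * p := by
  have hp0 : p ≠ 0 := by
    rintro rfl
    simp [ellipseForm] at hp
  have hr : 0 < ‖p‖ := norm_pos_iff.2 hp0
  -- K = tan φ, the value forced by the initial speed.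
  set K : ℝ := √(2 * P.VE p) / ‖p‖ / P.ω with hK
  have hK0 : 0 < K := by positivity
  set φ := Real.arctan K with hφ
  have hφ0 : 0 < φ := Real.arctan_pos.2 hK0
  have hφ1 : φ < Real.pi / 2 := Real.arctan_lt_pi_div_two K
  have hcos : 0 < Real.cos φ := Real.cos_arctan_pos K
  have htan : Real.sin φ = K * Real.cos φ := by
    have := Real.tan_arctan K
    rw [← hφ, Real.tan_eq_sin_div_cos, div_eq_iff hcos.ne'] at this
    exact this
  have hωK : P.ω * K = √(2 * P.VE p) / ‖p‖ := by rw [hK]; field_simp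
  have hlin : ∀ s, HasDerivAt (fun s : ℝ => P.ω * s - φ) P.ω s := fun s => by
    simpa using ((hasDerivAt_id s).const_mul P.ω).sub_const φ
  have h1 : ∀ s, HasDerivAt (fun s : ℝ => Real.cos (P.ω * s - φ) / Real.cos φ)
      (-(P.ω * Real.sin (P.ω * s - φ) / Real.cos φ)) s := fun s => by
    have := ((Real.hasDerivAt_cos _).comp s (hlin s)).div_const (Real.cos φ)
    refine this.congr_deriv ?_
    ring
  have h2 : ∀ s, HasDerivAt (fun s : ℝ => -(P.ω * Real.sin (P.ω * s - φ) / Real.cos φ))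
      (-(P.ω ^ 2) * (Real.cos (P.ω * s - φ) / Real.cos φ)) s := fun s => by
    have := ((((Real.hasDerivAt_sin _).comp s (hlin s)).const_mul P.ω).div_const (Real.cos φ)).neg
    refine this.congr_deriv ?_
    ring
  have hT : P.ω * (2 * φ / P.ω) - φ = φ := by field_simp; ring
  refine ⟨fun s => ((Real.cos (P.ω * s - φ) / Real.cos φ : ℝ) : ℂ) * p,
    fun s => ((-(P.ω * Real.sin (P.ω * s - φ) / Real.cos φ) : ℝ) : ℂ) * p, 2 * φ / P.ω,
    ⟨by positivity, ?_, ?_, ?_, ?_⟩, ?_, ?_, ?_, ?_⟩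
  · intro s _
    exact ((h1 s).ofReal_comp.mul_const p).hasDerivWithinAt
  · intro s _
    refine (((h2 s).ofReal_comp.mul_const p).congr_deriv ?_).hasDerivWithinAt
    push_cast
    ring
  · intro s _
    have hsc := Real.sin_sq_add_cos_sq (P.ω * s - φ)
    have hsc' := Real.sin_sq_add_cos_sq φ
    have hE : P.ω ^ 2 * K ^ 2 * ‖p‖ ^ 2 = 2 * P.VE p := by
      rw [← mul_pow, hωK, div_pow, Real.sq_sqrt (by positivity)]
      field_simp
    simp only [VE] at hE ⊢
    rw [norm_mul, norm_mul, Complex.norm_real, Complex.norm_real, mul_pow, mul_pow,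
      Real.norm_eq_abs, Real.norm_eq_abs, sq_abs, sq_abs]
    rw [htan] at hsc'
    have hk : (1 + K ^ 2) * Real.cos φ ^ 2 = 1 := by linarith
    have hk' : 1 / Real.cos φ ^ 2 = 1 + K ^ 2 := by
      rw [div_eq_iff (by positivity)]; exact hk.symm
    have : (-(P.ω * Real.sin (P.ω * s - φ) / Real.cos φ)) ^ 2 * ‖p‖ ^ 2 / 2 -
        (P.E - P.ω ^ 2 / 2 * ((Real.cos (P.ω * s - φ) / Real.cos φ) ^ 2 * ‖p‖ ^ 2))
        = P.ω ^ 2 * ‖p‖ ^ 2 / 2 * (Real.sin (P.ω * s - φ) ^ 2 + Real.cos (P.ω * s - φ) ^ 2)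
          * (1 / Real.cos φ ^ 2) - P.E := by ring
    rw [this, hk', hsc]
    linarith
  · intro s hs hcl
    have hle := P.ellipseForm_le_one_of_mem_closure hcl
    rw [ellipseForm_real_mul, hp, mul_one] at hle
    have hs1 : P.ω * s < 2 * φ := by
      have := hs.2
      rw [lt_div_iff₀ hω] at this
      linarith
    have hs0 : 0 < P.ω * s := mul_pos hω hs.1
    have hlt : Real.cos φ < Real.cos (P.ω * s - φ) := by
      rw [← Real.cos_abs (P.ω * s - φ)]
      refine Real.cos_lt_cos_of_nonneg_of_le_pi_div_two (abs_nonneg _) hφ1.le ?_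
      rw [abs_lt]
      constructor <;> linarith
    have : 1 < Real.cos (P.ω * s - φ) / Real.cos φ := by rwa [one_lt_div hcos]
    nlinarith
  · simp [hcos.ne']
  · simp only [mul_zero, zero_sub, Real.sin_neg, htan]
    congr 2
    rw [← hωK]
    field_simp
  · simp only [hT]
    simp [hcos.ne']
  · simp only [hT, htan]
    congr 2
    rw [← hωK]
    field_simp

end GalaxyParams

/-! ### Keplerian arcs in Levi-Civita coordinates. -/

/-- Inverse of the primitive of a continuous function bounded below by a positive constant. -/
lemma exists_time_change {ρ : ℝ → ℝ} (hρ : Continuous ρ) {δ : ℝ} (hδ : 0 < δ)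
    (hle : ∀ s, δ ≤ ρ s) {σ : ℝ} (hσ : 0 < σ) :
    ∃ (s : ℝ → ℝ) (S : ℝ), 0 < S ∧ s 0 = 0 ∧ s S = σ ∧ (∀ t ∈ Ioo 0 S, s t ∈ Ioo 0 σ) ∧
      ∀ t, HasDerivAt s (ρ (s t))⁻¹ t := by
  set τ : ℝ → ℝ := fun s => ∫ x in (0 : ℝ)..s, ρ x with hτ
  have hd : ∀ s, HasDerivAt τ (ρ s) s := fun s => hρ.integral_hasStrictDerivAt 0 s |>.hasDerivAt
  have hτ0 : τ 0 = 0 := by simp [hτ]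
  have hpos : ∀ s, 0 < ρ s := fun s => hδ.trans_le (hle s)
  have hmono : StrictMono τ := strictMono_of_hasDerivAt_pos hd hpos
  have hcont : Continuous τ := continuous_iff_continuousAt.2 fun s => (hd s).continuousAt
  have hmono' : Monotone fun s => τ s - δ * s := by
    refine monotone_of_hasDerivAt_nonneg (f' := fun s => ρ s - δ) (fun s => ?_) (fun s => ?_)
    · exact ((hd s).sub ((hasDerivAt_id s).const_mul δ)).congr_deriv (by simp)
    · exact sub_nonneg.2 (hle s)
  have hsurj : Function.Surjective τ := by
    refine hcont.surjective ?_ ?_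
    · refine Filter.tendsto_atTop_mono' _ ?_ (Filter.tendsto_id.const_mul_atTop hδ)
      filter_upwards [Filter.eventually_ge_atTop 0] with s hs
      have := hmono' hs
      simp only [hτ0, mul_zero, sub_zero, id] at this ⊢
      linarith
    · refine Filter.tendsto_atBot_mono' _ ?_ (Filter.tendsto_id.const_mul_atBot hδ)
      filter_upwards [Filter.eventually_le_atBot 0] with s hs
      have := hmono' hs
      simp only [hτ0, mul_zero, sub_zero, id] at this ⊢
      linarith
  set e := hmono.orderIsoOfSurjective τ hsurj with he
  have hes : ∀ x, e x = τ x := fun x => rfl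
  have h0 : e.symm 0 = 0 := by rw [OrderIso.symm_apply_eq, hes, hτ0]
  have hS : e.symm (τ σ) = σ := by rw [OrderIso.symm_apply_eq, hes]
  refine ⟨e.symm, τ σ, hτ0 ▸ hmono hσ, h0, hS, fun t ht => ⟨?_, ?_⟩, fun t => ?_⟩
  · rw [← h0]; exact e.symm.strictMono ht.1
  · rw [← hS]; exact e.symm.strictMono ht.2
  · exact (hd (e.symm t)).of_local_left_inverse e.symm.continuous.continuousAt (hpos _).ne'
      (Filter.Eventually.of_forall fun y => e.apply_symm_apply y)

/-- The solution `P cosh s + W sinh s` of `ζ'' = ζ`. -/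
def hypArc (P W : ℂ) (s : ℝ) : ℂ := (Real.cosh s : ℂ) * P + (Real.sinh s : ℂ) * W

lemma hasDerivAt_hypArc (P W : ℂ) (s : ℝ) : HasDerivAt (hypArc P W) (hypArc W P s) s := by
  have h1 := (Real.hasDerivAt_cosh s).ofReal_comp.mul_const P
  have h2 := (Real.hasDerivAt_sinh s).ofReal_comp.mul_const W
  refine (h1.add h2).congr_deriv ?_
  simp only [hypArc]
  ring

lemma continuous_hypArc (P W : ℂ) : Continuous (hypArc P W) :=
  continuous_iff_continuousAt.2 fun s => (hasDerivAt_hypArc P W s).continuousAt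

/-- Energy integral of ζ'' = ζ; the derivative of `hypArc P W` is `hypArc W P`. -/
lemma hypArc_energy (P W : ℂ) (s : ℝ) :
    ‖hypArc W P s‖ ^ 2 - ‖hypArc P W s‖ ^ 2 = ‖W‖ ^ 2 - ‖P‖ ^ 2 := by
  have := Real.cosh_sq s
  simp only [← Complex.normSq_eq_norm_sq, Complex.normSq_apply, hypArc, Complex.add_re,
    Complex.add_im, Complex.re_ofReal_mul, Complex.im_ofReal_mul]
  linear_combination (W.re * W.re + W.im * W.im - (P.re * P.re + P.im * P.im)) * this

/-- Angular momentum, the imaginary part of conj(ζ) ζ'. -/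
lemma hypArc_im (P W : ℂ) (s : ℝ) :
    (hypArc P W s).re * (hypArc W P s).im - (hypArc P W s).im * (hypArc W P s).re =
      P.re * W.im - P.im * W.re := by
  have := Real.cosh_sq s
  simp only [hypArc, Complex.add_re,
    Complex.add_im, Complex.re_ofReal_mul, Complex.im_ofReal_mul]
  linear_combination (P.re * W.im - P.im * W.re) * this

/-- Nonzero angular momentum J keeps the arc away from the collision: by Cauchy–Schwarz J² ≤ |ζ|²
|ζ'|² = x (x + M), with x = |ζ|² and M the conserved energy difference. The uniform bound makes the
time change invertible on the whole line. -/
lemma exists_le_norm_hypArc {P W : ℂ} (h : P.re * W.im - P.im * W.re ≠ 0) (hE : ‖P‖ < ‖W‖) :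
    ∃ δ : ℝ, 0 < δ ∧ ∀ s, δ ≤ ‖hypArc P W s‖ ^ 2 := by
  set J := P.re * W.im - P.im * W.re with hJ
  set M := ‖W‖ ^ 2 - ‖P‖ ^ 2 with hM
  have hM0 : 0 < M := by
    have := norm_nonneg P
    rw [hM]; nlinarith
  have hJ0 : 0 < J ^ 2 := by positivity
  refine ⟨min 1 (J ^ 2 / (1 + M)), by positivity, fun s => ?_⟩
  set x := ‖hypArc P W s‖ ^ 2 with hx
  have hx0 : 0 ≤ x := by positivity
  have h1 := hypArc_energy P W s
  have h2 := hypArc_im P W s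
  have h3 : J ^ 2 ≤ x * (x + M) := by
    have : x + M = ‖hypArc W P s‖ ^ 2 := by rw [hx, hM, ← h1]; ring
    rw [this, hx, hJ, ← h2, ← Complex.normSq_eq_norm_sq, ← Complex.normSq_eq_norm_sq,
      Complex.normSq_apply, Complex.normSq_apply]
    nlinarith [sq_nonneg ((hypArc P W s).re * (hypArc W P s).re +
      (hypArc P W s).im * (hypArc W P s).im)]
  by_contra! hlt
  have hx1 : x < 1 := hlt.trans_le (min_le_left _ _)
  have hx2 : x < J ^ 2 / (1 + M) := hlt.trans_le (min_le_right _ _)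
  rw [lt_div_iff₀ (by positivity)] at hx2
  nlinarith

namespace GalaxyParams

variable (P : GalaxyParams)

/-- The square of a hyperbolic arc stays inside a convex-enough ellipse through its end points. -/
lemma hypArc_sq_mem_D (hb0 : 0 < P.b) (hb1 : P.b ≤ 1) (hb : 1 ≤ 2 * P.b ^ 2) {A W : ℂ} {σ : ℝ}
    (hne : ∀ s, hypArc A W s ≠ 0)
    (h0 : P.ellipseForm (A ^ 2) = 1) (h1 : P.ellipseForm (hypArc A W σ ^ 2) = 1) :
    ∀ s ∈ Ioo 0 σ, hypArc A W s ^ 2 ∈ P.D := by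
  set ζ := hypArc A W with hζ
  set ζ' := hypArc W A with hζ'
  have hz : ∀ s, HasDerivAt (fun s => ζ s ^ 2) (2 * ζ s * ζ' s) s := fun s => by
    exact ((hasDerivAt_hypArc A W s).pow 2).congr_deriv (by simp [hζ, hζ'])
  have hz' : ∀ s, HasDerivAt (fun s => 2 * ζ s * ζ' s) (2 * ζ' s ^ 2 + 2 * ζ s ^ 2) s := fun s => by
    refine (((hasDerivAt_hypArc A W s).const_mul 2).mul (hasDerivAt_hypArc W A s)).congr_deriv ?_
    simp only [hζ, hζ']
    ring
  have hre : ∀ {f : ℝ → ℂ} {f' : ℂ} {s : ℝ}, HasDerivAt f f' s →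
      HasDerivAt (fun s => (f s).re) f'.re s := fun h =>
    (Complex.reCLM.hasFDerivAt.comp_hasDerivAt _ h)
  have him : ∀ {f : ℝ → ℂ} {f' : ℂ} {s : ℝ}, HasDerivAt f f' s →
      HasDerivAt (fun s => (f s).im) f'.im s := fun h =>
    (Complex.imCLM.hasFDerivAt.comp_hasDerivAt _ h)
  set q : ℝ → ℝ := fun s => P.ellipseForm (ζ s ^ 2) with hq
  set q' : ℝ → ℝ := fun s => 2 * ((ζ s ^ 2).re * (2 * ζ s * ζ' s).re) +
    2 * ((ζ s ^ 2).im * (2 * ζ s * ζ' s).im) / P.b ^ 2 with hq'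
  have hqd : ∀ s, HasDerivAt q (q' s) s := fun s => by
    have := ((hre (hz s)).pow 2).add (((him (hz s)).pow 2).div_const (P.b ^ 2))
    refine this.congr_deriv ?_
    simp only [hq']
    norm_num
    ring
  set q'' : ℝ → ℝ := fun s =>
    2 * ((2 * ζ s * ζ' s).re ^ 2 + (ζ s ^ 2).re * (2 * ζ' s ^ 2 + 2 * ζ s ^ 2).re) +
    2 * ((2 * ζ s * ζ' s).im ^ 2 + (ζ s ^ 2).im * (2 * ζ' s ^ 2 + 2 * ζ s ^ 2).im) / P.b ^ 2
    with hq''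
  have hqd' : ∀ s, HasDerivAt q' (q'' s) s := fun s => by
    have := (((hre (hz s)).mul (hre (hz' s))).const_mul 2).add
      ((((him (hz s)).mul (him (hz' s))).const_mul 2).div_const (P.b ^ 2))
    refine this.congr_deriv ?_
    simp only [hq'']
    ring
  have hpos : ∀ s, 0 < q'' s := fun s => by
    set β := 1 / P.b ^ 2 with hβ
    have hβ1 : 1 ≤ β := by
      rw [hβ, le_div_iff₀ (by positivity)]
      nlinarith
    have hβ2 : β ≤ 2 := by
      rw [hβ, div_le_iff₀ (by positivity)]
      exact hb
    obtain ⟨x, y, hxy⟩ : ∃ x y, ζ s = ⟨x, y⟩ := ⟨_, _, rfl⟩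
    obtain ⟨v, w, hvw⟩ : ∃ v w, ζ' s = ⟨v, w⟩ := ⟨_, _, rfl⟩
    have hxy0 : 0 < x ^ 2 + y ^ 2 := by
      have := hne s
      rw [hxy] at this
      by_contra! hcon
      apply this
      have hx : x = 0 := by nlinarith [sq_nonneg x, sq_nonneg y]
      have hy : y = 0 := by nlinarith [sq_nonneg x, sq_nonneg y]
      rw [hx, hy]; rfl
    have hq2 : q'' s = 2 * (4 * (x * v - y * w) ^ 2 + 2 * (x ^ 2 - y ^ 2) * (v ^ 2 - w ^ 2)
        + 2 * (x ^ 2 - y ^ 2) ^ 2) + 2 * β * (4 * (x * w + y * v) ^ 2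
        + 2 * (2 * x * y) * (2 * v * w) + 2 * (2 * x * y) ^ 2) := by
      simp only [hq'', hxy, hvw, hβ, pow_two, Complex.mul_re, Complex.mul_im, Complex.add_re,
        Complex.add_im, Complex.re_ofNat, Complex.im_ofNat]
      ring
    rw [hq2]
    -- q'' is affine in β ∈ [1, 2], so it is split with the weights 2 - β and β - 1 into sums of
    -- squares: q'' / 4 is e1 + e2 + e3 / 2 + e4, where |ζ|⁴ gives strictness. This is where 1 ≤ 2b²
    -- is used.
    have e1 : 0 ≤ (2 - β) * (3 * (x * v + y * w) ^ 2 + (x * w - y * v) ^ 2) :=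
      mul_nonneg (by linarith) (by positivity)
    have e2 : 0 ≤ (β - 1) * (3 * (x * v + y * w) ^ 2 + (x * w + y * v) ^ 2) :=
      mul_nonneg (by linarith) (by positivity)
    have e3 : 0 ≤ (β - 1) * (4 * (x * w + y * v) ^ 2 + 2 * (2 * x * y) ^ 2) :=
      mul_nonneg (by linarith) (by positivity)
    have e4 : 0 < (x ^ 2 + y ^ 2) ^ 2 := by positivity
    nlinarith
  have hdq : deriv q = q' := funext fun s => (hqd s).deriv
  have hconv : StrictConvexOn ℝ univ q := by
    refine strictConvexOn_univ_of_deriv2_pos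
      (continuous_iff_continuousAt.2 fun s => (hqd s).continuousAt) fun s => ?_
    rw [Function.iterate_succ, Function.comp_apply, Function.iterate_one, hdq, (hqd' s).deriv]
    exact hpos s
  intro s hs
  have hσ : (0 : ℝ) < σ := hs.1.trans hs.2
  have hseg : s ∈ openSegment ℝ 0 σ := by rwa [openSegment_eq_Ioo hσ]
  have hlt := hconv.lt_on_openSegment (mem_univ 0) (mem_univ σ) hσ.ne hseg
  have hq0 : q 0 = 1 := by simpa [hq, hζ, hypArc] using h0
  have hqσ : q σ = 1 := h1
  rw [hq0, hqσ, max_self] at hlt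
  exact hlt

/-- A Keplerian arc of positive energy in Levi-Civita coordinates. -/
lemma exists_innerArc (hb0 : 0 < P.b) (hb1 : P.b ≤ 1) (hb : 1 ≤ 2 * P.b ^ 2)
    (hE : 0 < P.E + P.h) (hμ : 0 < P.μ) {A W : ℂ} {σ : ℝ} (hσ : 0 < σ)
    (hJ : A.re * W.im - A.im * W.re ≠ 0) (hen : ‖W‖ ^ 2 - ‖A‖ ^ 2 = P.μ / (P.E + P.h))
    (h0 : P.ellipseForm (A ^ 2) = 1) (h1 : P.ellipseForm (hypArc A W σ ^ 2) = 1) :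
    ∃ (z u : ℝ → ℂ) (S : ℝ), P.IsInnerArc z u S ∧ z 0 = A ^ 2 ∧ z S = hypArc A W σ ^ 2 ∧
      u 0 = (√(2 * (P.E + P.h)) : ℂ) * (W / (starRingEnd ℂ) A) ∧
      u S = (√(2 * (P.E + P.h)) : ℂ) * (hypArc W A σ / (starRingEnd ℂ) (hypArc A W σ)) := by
  set En := P.E + P.h with hEn
  have hAW : ‖A‖ < ‖W‖ := by
    have : 0 < P.μ / En := by positivity
    nlinarith [norm_nonneg A, norm_nonneg W]
  obtain ⟨δ, hδ, hle⟩ := exists_le_norm_hypArc hJ hAW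
  have hne : ∀ s, hypArc A W s ≠ 0 := fun s hs => by
    have := hle s
    rw [hs] at this
    simp at this
    linarith
  -- Time scale dt = c |ζ|² ds, chosen so that dz/dt = 2ζζ' / (c|ζ|²) equals √(2En) ζ' / conj ζ and
  -- the energy of ζ matches zero total energy.
  set c : ℝ := 2 / √(2 * En) with hc
  have hsq : 0 < √(2 * En) := by positivity
  have hsq2 : √(2 * En) ^ 2 = 2 * En := Real.sq_sqrt (by positivity)
  have hc0 : 0 < c := by positivity
  obtain ⟨s, S, hS, hs0, hsS, hsI, hsd⟩ :=
    exists_time_change (ρ := fun s => c * ‖hypArc A W s‖ ^ 2)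
      (by have := continuous_hypArc A W; fun_prop) (mul_pos hc0 hδ)
      (fun s => mul_le_mul_of_nonneg_left (hle s) hc0.le) hσ
  have hin := P.hypArc_sq_mem_D hb0 hb1 hb hne h0 h1
  have hconj : ∀ f : ℝ → ℂ, ∀ f' t, HasDerivAt f f' t →
      HasDerivAt (fun t => (starRingEnd ℂ) (f t)) ((starRingEnd ℂ) f') t := fun f f' t h =>
    (Complex.conjCLE.toContinuousLinearMap.hasFDerivAt.comp_hasDerivAt _ h)
  have hzd : ∀ t, HasDerivAt (fun t => hypArc A W (s t) ^ 2)
      ((√(2 * En) : ℂ) * (hypArc W A (s t) / (starRingEnd ℂ) (hypArc A W (s t)))) t := fun t => by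
    have h := ((hasDerivAt_hypArc A W (s t)).scomp t (hsd t)).pow 2
    refine h.congr_deriv ?_
    have hn := hne (s t)
    have hn' : (starRingEnd ℂ) (hypArc A W (s t)) ≠ 0 := by simpa using hn
    have hnn : ((‖hypArc A W (s t)‖ : ℂ)) ^ 2 =
        hypArc A W (s t) * (starRingEnd ℂ) (hypArc A W (s t)) := by
      rw [Complex.mul_conj, Complex.normSq_eq_norm_sq]; push_cast; rfl
    have hcs : ((√(2 * En) : ℝ) : ℂ) ≠ 0 := by exact_mod_cast hsq.ne'
    simp only [hc, Complex.real_smul, Function.comp_apply]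
    push_cast
    rw [hnn]
    field_simp
  have hud : ∀ t, HasDerivAt
      (fun t => (√(2 * En) : ℂ) * (hypArc W A (s t) / (starRingEnd ℂ) (hypArc A W (s t))))
      (-((P.μ / ‖hypArc A W (s t) ^ 2‖ ^ 3 : ℝ) : ℂ) * hypArc A W (s t) ^ 2) t := fun t => by
    have hn := hne (s t)
    have hn' : (starRingEnd ℂ) (hypArc A W (s t)) ≠ 0 := by simpa using hn
    have h := (((hasDerivAt_hypArc W A (s t)).scomp t (hsd t)).div
      (hconj _ _ _ ((hasDerivAt_hypArc A W (s t)).scomp t (hsd t))) hn').const_mul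
      ((√(2 * En) : ℝ) : ℂ)
    refine h.congr_deriv ?_
    have hnn : ((‖hypArc A W (s t)‖ : ℂ)) ^ 2 =
        hypArc A W (s t) * (starRingEnd ℂ) (hypArc A W (s t)) := by
      rw [Complex.mul_conj, Complex.normSq_eq_norm_sq]; push_cast; rfl
    have hcs : ((√(2 * En) : ℝ) : ℂ) ≠ 0 := by exact_mod_cast hsq.ne'
    have hcs2 : ((√(2 * En) : ℝ) : ℂ) ^ 2 = 2 * En := by exact_mod_cast hsq2
    have hEn0 : (En : ℂ) ≠ 0 := by exact_mod_cast hE.ne'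
    have hene : hypArc W A (s t) * (starRingEnd ℂ) (hypArc W A (s t)) -
        hypArc A W (s t) * (starRingEnd ℂ) (hypArc A W (s t)) = (P.μ : ℂ) / En := by
      rw [Complex.mul_conj, Complex.mul_conj, Complex.normSq_eq_norm_sq,
        Complex.normSq_eq_norm_sq, ← Complex.ofReal_sub, hypArc_energy, hen]
      push_cast; rfl
    have hmu : (P.μ : ℂ) = En * (hypArc W A (s t) * (starRingEnd ℂ) (hypArc W A (s t)) -
        hypArc A W (s t) * (starRingEnd ℂ) (hypArc A W (s t))) := by
      rw [hene]; field_simp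
    have h6 : ((‖hypArc A W (s t) ^ 2‖ : ℂ)) ^ 3 =
        (hypArc A W (s t) * (starRingEnd ℂ) (hypArc A W (s t))) ^ 3 := by
      rw [← hnn, norm_pow]; push_cast; ring
    simp only [hc, Complex.real_smul, Function.comp_apply, map_mul, Complex.conj_ofReal]
    push_cast
    rw [hnn, h6, hmu]
    field_simp
    rw [hcs2]
    ring
  refine ⟨fun t => hypArc A W (s t) ^ 2,
    fun t => (√(2 * En) : ℂ) * (hypArc W A (s t) / (starRingEnd ℂ) (hypArc A W (s t))), S,
    ⟨hS, ?_, ?_, ?_, ?_, ?_, ?_⟩, ?_, ?_, ?_, ?_⟩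
  · exact fun t _ => (hzd t).continuousAt.continuousWithinAt
  · exact fun t _ _ => (hzd t).hasDerivWithinAt
  · exact fun t _ _ => (hud t).hasDerivWithinAt
  · intro t _ _
    have hn : 0 < ‖hypArc A W (s t)‖ := norm_pos_iff.2 (hne _)
    have := hypArc_energy A W (s t)
    rw [hen, eq_div_iff hE.ne'] at this
    simp only [VI, ← hEn]
    rw [norm_mul, norm_div, Complex.norm_real, Real.norm_of_nonneg hsq.le, RCLike.norm_conj,
      norm_pow, mul_pow, div_pow, hsq2]
    field_simp
    linarith
  -- The arc avoids the origin, so the reflection rule is vacuous.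
  · exact fun t _ h => absurd h (pow_ne_zero 2 (hne _))
  · exact fun t ht => hin _ (hsI t ht)
  · simp [hs0, hypArc]
  · simp [hsS]
  · simp [hs0, hypArc]
  · simp [hsS]

end GalaxyParams

/-! ### Tangent and normal of the ellipse, radial velocities, refraction. -/

namespace GalaxyParams

variable (P : GalaxyParams)

lemma inner_eq_re_im (v w : ℂ) : inner ℝ v w = v.re * w.re + v.im * w.im := by
  rw [Complex.inner, Complex.mul_re, Complex.conj_re, Complex.conj_im]
  ring

lemma γ'_ne_zero (hb : 0 < P.b) (ξ : ℝ) : P.γ' ξ ≠ 0 := by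
  intro h
  have h1 : -Real.sin ξ = 0 := congrArg Complex.re h
  have h2 : P.b * Real.cos ξ = 0 := congrArg Complex.im h
  have h3 : Real.cos ξ = 0 := by simpa [hb.ne'] using h2
  have := Real.cos_sq_add_sin_sq ξ
  simp_all

lemma γ_ne_zero (hb : 0 < P.b) (ξ : ℝ) : P.γ ξ ≠ 0 := by
  intro h
  have := P.ellipseForm_γ hb ξ
  simp [h, ellipseForm] at this

lemma norm_γ_sq (ξ : ℝ) : ‖P.γ ξ‖ ^ 2 = Real.cos ξ ^ 2 + P.b ^ 2 * Real.sin ξ ^ 2 := by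
  rw [← Complex.normSq_eq_norm_sq, Complex.normSq_apply]
  simp only [γ]
  ring

lemma norm_γ_le_one (hb0 : 0 < P.b) (hb1 : P.b ≤ 1) (ξ : ℝ) : ‖P.γ ξ‖ ≤ 1 := by
  have h := P.norm_γ_sq ξ
  have := Real.cos_sq_add_sin_sq ξ
  have hb2 : P.b ^ 2 ≤ 1 := pow_le_one₀ hb0.le hb1
  have : P.b ^ 2 * Real.sin ξ ^ 2 ≤ Real.sin ξ ^ 2 := mul_le_of_le_one_left (sq_nonneg _) hb2
  rw [← sq_le_one_iff₀ (norm_nonneg _)]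
  linarith

lemma norm_γ'_le_one (hb0 : 0 < P.b) (hb1 : P.b ≤ 1) (ξ : ℝ) : ‖P.γ' ξ‖ ≤ 1 := by
  have h : ‖P.γ' ξ‖ ^ 2 = Real.sin ξ ^ 2 + P.b ^ 2 * Real.cos ξ ^ 2 := by
    rw [← Complex.normSq_eq_norm_sq, Complex.normSq_apply]
    simp only [γ']
    ring
  have := Real.cos_sq_add_sin_sq ξ
  have hb2 : P.b ^ 2 ≤ 1 := pow_le_one₀ hb0.le hb1
  have : P.b ^ 2 * Real.cos ξ ^ 2 ≤ Real.cos ξ ^ 2 := mul_le_of_le_one_left (sq_nonneg _) hb2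
  rw [← sq_le_one_iff₀ (norm_nonneg _)]
  linarith

lemma VE_γ_pos (hb0 : 0 < P.b) (hb1 : P.b ≤ 1) (hE : P.ω ^ 2 < 2 * P.E) (ξ : ℝ) :
    0 < P.VE (P.γ ξ) := by
  have h1 : ‖P.γ ξ‖ ^ 2 ≤ 1 := pow_le_one₀ (norm_nonneg _) (P.norm_γ_le_one hb0 hb1 ξ)
  have h2 := mul_le_of_le_one_right (sq_nonneg P.ω) h1
  simp only [VE]
  linarith

lemma inner_γ_γ' (ξ : ℝ) :
    inner ℝ (P.γ ξ) (P.γ' ξ) = -((1 - P.b ^ 2) * (Real.sin ξ * Real.cos ξ)) := by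
  rw [inner_eq_re_im]
  simp only [γ, γ']
  ring

lemma inner_tangent (v : ℂ) (ξ : ℝ) :
    inner ℝ v (P.tangent ξ) = inner ℝ v (P.γ' ξ) / ‖P.γ' ξ‖ := by
  simp only [tangent, inner_eq_re_im, Complex.re_ofReal_mul, Complex.im_ofReal_mul]
  ring

lemma inner_γ_normal (ξ : ℝ) : inner ℝ (P.γ ξ) (P.normal ξ) = P.b / ‖P.γ' ξ‖ := by
  have := Real.cos_sq_add_sin_sq ξ
  simp only [normal, tangent, inner_eq_re_im, γ, γ', Complex.mul_re, Complex.mul_im,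
    Complex.neg_re, Complex.neg_im, Complex.I_re, Complex.I_im, Complex.ofReal_re,
    Complex.ofReal_im]
  rw [div_eq_mul_inv]
  linear_combination (P.b * ‖(⟨-Real.sin ξ, P.b * Real.cos ξ⟩ : ℂ)‖⁻¹) * this

lemma norm_tangent (hb : 0 < P.b) (ξ : ℝ) : ‖P.tangent ξ‖ = 1 := by
  have := norm_pos_iff.2 (P.γ'_ne_zero hb ξ)
  rw [tangent, norm_mul, Complex.norm_real, Real.norm_of_nonneg (by positivity),
    inv_mul_cancel₀ this.ne']

lemma norm_normal (hb : 0 < P.b) (ξ : ℝ) : ‖P.normal ξ‖ = 1 := by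
  simp [normal, P.norm_tangent hb]

lemma eq_inner_normal_add_inner_tangent (hb : 0 < P.b) (v : ℂ) (ξ : ℝ) :
    v = ((inner ℝ v (P.normal ξ) : ℝ) : ℂ) * P.normal ξ +
      ((inner ℝ v (P.tangent ξ) : ℝ) : ℂ) * P.tangent ξ := by
  have h : (P.tangent ξ).re ^ 2 + (P.tangent ξ).im ^ 2 = 1 := by
    have := P.norm_tangent hb ξ
    rw [← sq_eq_sq₀ (norm_nonneg _) zero_le_one, ← Complex.normSq_eq_norm_sq,
      Complex.normSq_apply] at this
    linarith
  apply Complex.ext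
  · simp only [normal, inner_eq_re_im, Complex.add_re, Complex.mul_re, Complex.mul_im,
      Complex.neg_re, Complex.neg_im, Complex.I_re, Complex.I_im, Complex.ofReal_re,
      Complex.ofReal_im]
    linear_combination (-v.re) * h
  · simp only [normal, inner_eq_re_im, Complex.add_im, Complex.mul_re, Complex.mul_im,
      Complex.neg_re, Complex.neg_im, Complex.I_re, Complex.I_im, Complex.ofReal_re,
      Complex.ofReal_im]
    linear_combination (-v.im) * h

lemma inner_normal_sq_add_inner_tangent_sq (hb : 0 < P.b) (v : ℂ) (ξ : ℝ) :
    inner ℝ v (P.normal ξ) ^ 2 + inner ℝ v (P.tangent ξ) ^ 2 = ‖v‖ ^ 2 := by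
  have h : (P.tangent ξ).re ^ 2 + (P.tangent ξ).im ^ 2 = 1 := by
    have := P.norm_tangent hb ξ
    rw [← sq_eq_sq₀ (norm_nonneg _) zero_le_one, ← Complex.normSq_eq_norm_sq,
      Complex.normSq_apply] at this
    linarith
  rw [← Complex.normSq_eq_norm_sq, Complex.normSq_apply]
  simp only [normal, inner_eq_re_im, Complex.mul_re,
      Complex.mul_im, Complex.neg_re, Complex.neg_im, Complex.I_re, Complex.I_im]
  linear_combination (v.re ^ 2 + v.im ^ 2) * h

/-- The point of the phase space over `γ(ξ)` whose outward velocity is radial. -/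
def radialPoint (ξ : ℝ) : ℝ × ℝ :=
  (ξ, Real.arcsin (inner ℝ (P.γ ξ) (P.tangent ξ) / ‖P.γ ξ‖))

lemma radialPoint_mem_phaseSpace {ξ : ℝ} (h : ξ ∈ Ico 0 (2 * Real.pi)) :
    P.radialPoint ξ ∈ phaseSpace :=
  ⟨h, Real.neg_pi_div_two_le_arcsin _, Real.arcsin_le_pi_div_two _⟩

lemma isRadial_radialPoint (hb : 0 < P.b) (ξ : ℝ) : P.IsRadial (P.radialPoint ξ) := by
  have hr := norm_pos_iff.2 (P.γ_ne_zero hb ξ)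
  have hg := norm_pos_iff.2 (P.γ'_ne_zero hb ξ)
  have hsq := P.inner_normal_sq_add_inner_tangent_sq hb (P.γ ξ) ξ
  have hn : 0 < inner ℝ (P.γ ξ) (P.normal ξ) := by rw [inner_γ_normal]; positivity
  have hd := P.eq_inner_normal_add_inner_tangent hb (P.γ ξ) ξ
  set a := inner ℝ (P.γ ξ) (P.normal ξ)
  set c := inner ℝ (P.γ ξ) (P.tangent ξ) with hc
  have hcr : |c / ‖P.γ ξ‖| ≤ 1 := by
    rw [abs_div, abs_norm, div_le_one hr, ← abs_norm (P.γ ξ), ← sq_le_sq]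
    nlinarith
  rw [abs_le] at hcr
  have hsin : Real.sin (Real.arcsin (c / ‖P.γ ξ‖)) = c / ‖P.γ ξ‖ := Real.sin_arcsin hcr.1 hcr.2
  have hcos : Real.cos (Real.arcsin (c / ‖P.γ ξ‖)) = a / ‖P.γ ξ‖ := by
    rw [Real.cos_arcsin, Real.sqrt_eq_iff_mul_self_eq_of_pos (by positivity)]
    field_simp
    linarith
  simp only [IsRadial, radialPoint, vel, ← hc, hsin, hcos]
  have : ((√(2 * P.VE (P.γ ξ)) / ‖P.γ ξ‖ : ℝ) : ℂ) * P.γ ξ =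
      ((√(2 * P.VE (P.γ ξ)) / ‖P.γ ξ‖ : ℝ) : ℂ) *
        ((a : ℂ) * P.normal ξ + (c : ℂ) * P.tangent ξ) := by rw [← hd]
  rw [this]
  push_cast
  ring

/-- With |v| = √(2V), the vector √V v / |v| is v / √2 on both sides, so Snell's law is continuity of
the tangential velocity. -/
lemma snell_of_inner_eq {ξ : ℝ} {v w : ℂ} (hE : 0 < P.VE (P.γ ξ)) (hI : 0 < P.VI (P.γ ξ))
    (hv : ‖v‖ = √(2 * P.VE (P.γ ξ))) (hw : ‖w‖ = √(2 * P.VI (P.γ ξ)))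
    (h : inner ℝ v (P.tangent ξ) = inner ℝ w (P.tangent ξ)) : P.Snell ξ v w := by
  have h1 : 0 < √(P.VE (P.γ ξ)) := Real.sqrt_pos.2 hE
  have h2 : 0 < √(P.VI (P.γ ξ)) := Real.sqrt_pos.2 hI
  have h3 : 0 < √(2 : ℝ) := by positivity
  rw [Snell, hv, hw, Real.sqrt_mul zero_le_two, Real.sqrt_mul zero_le_two, h]
  field_simp

/-! ### Links, and the periodic orbits they generate. -/

/-- Algebraic conditions, in Levi-Civita coordinates `A ^ 2 = γ(ξ₀)`, `B ^ 2 = γ(ξ₁)`, under which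
the Keplerian arc from `γ(ξ₀)` to `γ(ξ₁)` refracts into radial outer arcs at both ends. -/
structure IsLink (ξ₀ ξ₁ : ℝ) (A B : ℂ) (η : ℝ) : Prop where
  sqA : A ^ 2 = P.γ ξ₀
  sqB : B ^ 2 = P.γ ξ₁
  η_pos : 0 < η
  η_lt : η < P.b
  im_ne : A.re * B.im - A.im * B.re ≠ 0
  energy : η ^ 2 * (‖A‖ ^ 2 + ‖B‖ ^ 2) - 2 * η * √(1 + η ^ 2) * (A.re * B.re + A.im * B.im) =
    P.μ / (P.E + P.h)
  snell₀ : √(P.E + P.h) * (η * inner ℝ (A * B) (P.γ' ξ₀) +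
      √(1 + η ^ 2) * (1 - P.b ^ 2) * (Real.sin ξ₀ * Real.cos ξ₀)) =
    (1 - P.b ^ 2) * √(P.VE (P.γ ξ₀)) * (Real.sin ξ₀ * Real.cos ξ₀)
  snell₁ : √(P.E + P.h) * (η * inner ℝ (A * B) (P.γ' ξ₁) +
      √(1 + η ^ 2) * (1 - P.b ^ 2) * (Real.sin ξ₁ * Real.cos ξ₁)) =
    (1 - P.b ^ 2) * √(P.VE (P.γ ξ₁)) * (Real.sin ξ₁ * Real.cos ξ₁)

variable {P}

/-- Time reversal of the arc exchanges its ends. -/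
lemma IsLink.symm {ξ₀ ξ₁ : ℝ} {A B : ℂ} {η : ℝ} (h : P.IsLink ξ₀ ξ₁ A B η) :
    P.IsLink ξ₁ ξ₀ B A η where
  sqA := h.sqB
  sqB := h.sqA
  η_pos := h.η_pos
  η_lt := h.η_lt
  im_ne := fun h0 => h.im_ne (by linarith)
  energy := by rw [← h.energy]; ring
  snell₀ := by rw [mul_comm B A]; exact h.snell₁
  snell₁ := by rw [mul_comm B A]; exact h.snell₀

/-- The velocity `√(2E) (η A B - κ A²) / |A|²` has the tangential component of the radial one. -/
lemma inner_tangent_of_snell {ξ : ℝ} {A B : ℂ} {η En : ℝ} (hA : A ≠ 0)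
    (hsqA : A ^ 2 = P.γ ξ)
    (hs : √En * (η * inner ℝ (A * B) (P.γ' ξ) +
      √(1 + η ^ 2) * (1 - P.b ^ 2) * (Real.sin ξ * Real.cos ξ)) =
    (1 - P.b ^ 2) * √(P.VE (P.γ ξ)) * (Real.sin ξ * Real.cos ξ)) :
    inner ℝ (((-(√(2 * P.VE (P.γ ξ)) / ‖P.γ ξ‖) : ℝ) : ℂ) * P.γ ξ) (P.tangent ξ) =
      inner ℝ ((√(2 * En) : ℂ) * (((η : ℂ) * B - (√(1 + η ^ 2) : ℂ) * A) / (starRingEnd ℂ) A))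
        (P.tangent ξ) := by
  have hc : (starRingEnd ℂ) A ≠ 0 := by simpa using hA
  have hn : ‖P.γ ξ‖ = ‖A‖ ^ 2 := by rw [← hsqA, norm_pow]
  have hAn : 0 < ‖A‖ := norm_pos_iff.2 hA
  have e : (√(2 * En) : ℂ) * (((η : ℂ) * B - (√(1 + η ^ 2) : ℂ) * A) / (starRingEnd ℂ) A) =
      ((√(2 * En) / ‖A‖ ^ 2 : ℝ) : ℂ) *
        ((η : ℂ) * (A * B) - (√(1 + η ^ 2) : ℂ) * P.γ ξ) := by
    have hnn : ((‖A‖ : ℂ)) ^ 2 = A * (starRingEnd ℂ) A := by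
      rw [Complex.mul_conj, Complex.normSq_eq_norm_sq]; push_cast; rfl
    push_cast
    rw [hnn, ← hsqA]
    field_simp
  have hγ := P.inner_γ_γ' ξ
  rw [e, hn, inner_tangent, inner_tangent]
  congr 1
  rw [Real.sqrt_mul zero_le_two, Real.sqrt_mul zero_le_two]
  simp only [inner_eq_re_im, Complex.re_ofReal_mul, Complex.im_ofReal_mul, Complex.sub_re,
    Complex.sub_im] at hγ hs ⊢
  field_simp
  linear_combination (√En * √(1 + η ^ 2) - √(P.VE (P.γ ξ))) * hγ - hs

lemma IsLink.firstReturn {ξ₀ ξ₁ : ℝ} {A B : ℂ} {η : ℝ} (h : P.IsLink ξ₀ ξ₁ A B η)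
    (hb0 : 0 < P.b) (hb1 : P.b ≤ 1) (hb : 1 ≤ 2 * P.b ^ 2) (hω : 0 < P.ω)
    (hHill : P.ω ^ 2 < 2 * P.E) (hE : 0 < P.E + P.h) (hμ : 0 < P.μ)
    (h₀ : ξ₀ ∈ Ico 0 (2 * Real.pi)) (h₁ : ξ₁ ∈ Ico 0 (2 * Real.pi)) :
    P.FirstReturn (P.radialPoint ξ₀) (P.radialPoint ξ₁) := by
  have hV := P.VE_γ_pos hb0 hb1 hHill
  have hVI : ∀ ξ, 0 < P.VI (P.γ ξ) := fun ξ => by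
    have := norm_pos_iff.2 (P.γ_ne_zero hb0 ξ)
    simp only [VI]
    positivity
  obtain ⟨zE, uE, T, hO, hz0, hu0, hzT, huT⟩ :=
    P.exists_outerArc hω (P.ellipseForm_γ hb0 ξ₀) (hV ξ₀)
  -- The arc has η = 1 / sinh σ and κ = coth σ; W is the initial velocity for which A cosh s + W
  -- sinh s reaches B at s = σ.
  have hη := h.η_pos
  set κ := √(1 + η ^ 2) with hκ
  have hκ2 : κ ^ 2 = 1 + η ^ 2 := Real.sq_sqrt (by positivity)
  have hκ1 : 1 ≤ κ := Real.one_le_sqrt.2 (by nlinarith)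
  set W : ℂ := (η : ℂ) * B - (κ : ℂ) * A with hW
  set σ := Real.arsinh η⁻¹ with hσ
  have hσ0 : 0 < σ := Real.arsinh_pos_iff.2 (inv_pos.2 hη)
  have hsinh : Real.sinh σ = η⁻¹ := Real.sinh_arsinh _
  have hcosh : Real.cosh σ = κ / η := by
    rw [hσ, Real.cosh_arsinh, Real.sqrt_eq_iff_mul_self_eq_of_pos (by positivity)]
    field_simp
    rw [hκ2]; ring
  have hηc : (η : ℂ) ≠ 0 := by exact_mod_cast hη.ne'
  have hκc : (κ : ℂ) ^ 2 = 1 + (η : ℂ) ^ 2 := by exact_mod_cast hκ2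
  have hB : hypArc A W σ = B := by
    rw [hypArc, hsinh, hcosh, hW]
    push_cast
    field_simp
    ring
  -- The final velocity is minus the initial velocity of the reversed arc, so the refraction at B
  -- reduces to that at the start of `h.symm`.
  have hB' : hypArc W A σ = -((η : ℂ) * A - (κ : ℂ) * B) := by
    rw [hypArc, hsinh, hcosh, hW]
    push_cast
    field_simp
    linear_combination (-A) * hκc
  have hA0 : A ≠ 0 := by
    rintro rfl
    exact h.im_ne (by simp)
  have hB0 : B ≠ 0 := by
    rintro rfl
    exact h.im_ne (by simp)
  have hJ : A.re * W.im - A.im * W.re ≠ 0 := by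
    have : A.re * W.im - A.im * W.re = η * (A.re * B.im - A.im * B.re) := by
      simp [hW]; ring
    rw [this]
    exact mul_ne_zero hη.ne' h.im_ne
  have hen : ‖W‖ ^ 2 - ‖A‖ ^ 2 = P.μ / (P.E + P.h) := by
    rw [← h.energy, ← hκ, ← Complex.normSq_eq_norm_sq, ← Complex.normSq_eq_norm_sq,
      ← Complex.normSq_eq_norm_sq, Complex.normSq_apply, Complex.normSq_apply,
      Complex.normSq_apply]
    simp only [hW, Complex.sub_re, Complex.sub_im, Complex.re_ofReal_mul, Complex.im_ofReal_mul]
    linear_combination (A.re ^ 2 + A.im ^ 2) * hκ2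
  obtain ⟨zI, uI, S, hI, hzI0, hzIS, huI0, huIS⟩ := P.exists_innerArc hb0 hb1 hb hE hμ hσ0 hJ hen
    (by rw [h.sqA, P.ellipseForm_γ hb0]) (by rw [hB, h.sqB, P.ellipseForm_γ hb0])
  rw [hB, h.sqB] at hzIS
  rw [h.sqA] at hzI0
  rw [hB, hB'] at huIS
  have hnorm : ∀ ξ, ‖(((√(2 * P.VE (P.γ ξ)) / ‖P.γ ξ‖ : ℝ) : ℂ)) * P.γ ξ‖ =
      √(2 * P.VE (P.γ ξ)) := fun ξ => by
    have := norm_pos_iff.2 (P.γ_ne_zero hb0 ξ)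
    rw [norm_mul, Complex.norm_real, Real.norm_of_nonneg (by positivity)]
    field_simp
  have hnI : ∀ s ∈ Icc 0 S, ∀ ξ, zI s = P.γ ξ → ‖uI s‖ = √(2 * P.VI (P.γ ξ)) :=
    fun s hs ξ hξ => by
      have := hI.energy s hs (by rw [hξ]; exact P.γ_ne_zero hb0 ξ)
      rw [hξ] at this
      rw [eq_comm, Real.sqrt_eq_iff_mul_self_eq (by have := hVI ξ; positivity) (norm_nonneg _)]
      linarith
  -- The outer arc lands where it started, hence the intermediate parameter ξ₀.
  refine ⟨P.radialPoint_mem_phaseSpace h₀, P.radialPoint_mem_phaseSpace h₁,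
    zE, uE, zI, uI, T, S, ξ₀, hO, hz0, ?_, hzT, ?_, ?_, hI, hzI0, hzIS, ?_⟩
  · rw [hu0]; exact (P.isRadial_radialPoint hb0 ξ₀).symm
  · refine P.snell_of_inner_eq (hV _) (hVI _) ?_ (hnI 0 ⟨le_rfl, hI.pos.le⟩ _ hzI0) ?_
    · rw [huT, Complex.ofReal_neg, neg_mul, norm_neg, hnorm]
    · rw [huT, huI0]
      exact inner_tangent_of_snell hA0 h.sqA h.snell₀
  · have hc : (starRingEnd ℂ) A ≠ 0 := by simpa using hA0
    have hAn : 0 < ‖A‖ := norm_pos_iff.2 hA0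
    have e : uI 0 = ((√(2 * (P.E + P.h)) / ‖A‖ ^ 2 : ℝ) : ℂ) *
        ((η : ℂ) * (A * B) - (κ : ℂ) * P.γ ξ₀) := by
      have hnn : ((‖A‖ : ℂ)) ^ 2 = A * (starRingEnd ℂ) A := by
        rw [Complex.mul_conj, Complex.normSq_eq_norm_sq]; push_cast; rfl
      rw [huI0]
      push_cast
      rw [hnn, ← h.sqA, hW]
      field_simp
    have hi : inner ℝ (uI 0) (P.normal ξ₀) = √(2 * (P.E + P.h)) / ‖A‖ ^ 2 *
        (η * inner ℝ (A * B) (P.normal ξ₀) - κ * inner ℝ (P.γ ξ₀) (P.normal ξ₀)) := by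
      rw [e]
      simp only [inner_eq_re_im, Complex.re_ofReal_mul, Complex.im_ofReal_mul, Complex.sub_re,
        Complex.sub_im]
      ring
    -- The arc enters the domain because the normal velocity is a positive multiple of a number at
    -- most η - b, which is negative by `h.η_lt`.
    have hAB : inner ℝ (A * B) (P.normal ξ₀) ≤ 1 := by
      refine (real_inner_le_norm _ _).trans ?_
      rw [P.norm_normal hb0, mul_one, norm_mul]
      have h1 : ‖A‖ ≤ 1 := by
        rw [← sq_le_one_iff₀ (norm_nonneg _), ← norm_pow, h.sqA]
        exact P.norm_γ_le_one hb0 hb1 _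
      have h2 : ‖B‖ ≤ 1 := by
        rw [← sq_le_one_iff₀ (norm_nonneg _), ← norm_pow, h.sqB]
        exact P.norm_γ_le_one hb0 hb1 _
      exact mul_le_one₀ h1 (norm_nonneg _) h2
    have hbg : P.b ≤ P.b / ‖P.γ' ξ₀‖ :=
      le_div_self hb0.le (norm_pos_iff.2 (P.γ'_ne_zero hb0 _)) (P.norm_γ'_le_one hb0 hb1 _)
    rw [hi, inner_γ_normal]
    refine mul_neg_of_pos_of_neg (by positivity) ?_
    have h3 : η * inner ℝ (A * B) (P.normal ξ₀) ≤ η := mul_le_of_le_one_right hη.le hAB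
    have h4 : P.b ≤ κ * (P.b / ‖P.γ' ξ₀‖) := hbg.trans (le_mul_of_one_le_left (by positivity) hκ1)
    have := h.η_lt
    linarith
  · have hvel := P.isRadial_radialPoint hb0 ξ₁
    rw [IsRadial] at hvel
    rw [hvel]
    refine P.snell_of_inner_eq (hV _) (hVI _) (hnorm _) (hnI S ⟨hI.pos.le, le_rfl⟩ _ hzIS) ?_
    have := inner_tangent_of_snell hB0 h.symm.sqA h.symm.snell₀
    rw [← hκ] at this
    rw [huIS, neg_div, mul_neg, inner_neg_left]
    simp only [radialPoint]
    rw [← this, Complex.ofReal_neg, neg_mul, inner_neg_left, neg_neg]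

lemma IsLink.isTwoPeriodicBrakeOrbit {ξ₀ ξ₁ : ℝ} {A B : ℂ} {η : ℝ}
    (h : P.IsLink ξ₀ ξ₁ A B η) (hb0 : 0 < P.b) (hb1 : P.b < 1) (hb : 1 ≤ 2 * P.b ^ 2)
    (hω : 0 < P.ω) (hHill : P.ω ^ 2 < 2 * P.E) (hE : 0 < P.E + P.h) (hμ : 0 < P.μ)
    (h₀ : ξ₀ ∈ Ico 0 (2 * Real.pi)) (h₁ : ξ₁ ∈ Ico 0 (2 * Real.pi)) (hne : ξ₀ ≠ ξ₁)
    (hs₀ : Real.sin ξ₀ * Real.cos ξ₀ ≠ 0) (hs₁ : Real.sin ξ₁ * Real.cos ξ₁ ≠ 0) :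
    P.IsTwoPeriodicBrakeOrbit {P.radialPoint ξ₀, P.radialPoint ξ₁} := by
  have hhom : ∀ ξ, Real.sin ξ * Real.cos ξ ≠ 0 → ¬ P.IsHomothetic (P.radialPoint ξ) := by
    intro ξ hξ hh
    have h1 : inner ℝ (P.γ ξ) (P.γ' ξ) = 0 := hh.1
    rw [inner_γ_γ', neg_eq_zero] at h1
    refine mul_ne_zero ?_ hξ h1
    nlinarith
  refine ⟨_, _, rfl, fun heq => hne (congrArg Prod.fst heq),
    h.firstReturn hb0 hb1.le hb hω hHill hE hμ h₀ h₁,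
    h.symm.firstReturn hb0 hb1.le hb hω hHill hE hμ h₁ h₀,
    P.isRadial_radialPoint hb0 _, P.isRadial_radialPoint hb0 _, hhom _ hs₀, hhom _ hs₁⟩

/-- Reflection of a link in the major axis. -/
lemma IsLink.conj {ξ₀ ξ₁ : ℝ} {A B : ℂ} {η : ℝ} (h : P.IsLink ξ₀ ξ₁ A B η) :
    P.IsLink (2 * Real.pi - ξ₀) (2 * Real.pi - ξ₁) ((starRingEnd ℂ) A) ((starRingEnd ℂ) B) η := by
  have hγ : ∀ ξ, P.γ (2 * Real.pi - ξ) = (starRingEnd ℂ) (P.γ ξ) := fun ξ => by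
    apply Complex.ext <;> simp [γ, Real.cos_two_pi_sub, Real.sin_two_pi_sub]
  have hγ' : ∀ ξ, inner ℝ ((starRingEnd ℂ) A * (starRingEnd ℂ) B) (P.γ' (2 * Real.pi - ξ)) =
      -inner ℝ (A * B) (P.γ' ξ) := fun ξ => by
    simp only [inner_eq_re_im, γ', Real.cos_two_pi_sub, Real.sin_two_pi_sub, Complex.mul_re,
      Complex.mul_im, Complex.conj_re, Complex.conj_im]
    ring
  have hVE : ∀ ξ, P.VE (P.γ (2 * Real.pi - ξ)) = P.VE (P.γ ξ) := fun ξ => by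
    rw [hγ, VE, VE, RCLike.norm_conj]
  refine ⟨by rw [hγ, ← h.sqA, map_pow], by rw [hγ, ← h.sqB, map_pow], h.η_pos, h.η_lt,
    fun h0 => h.im_ne ?_, ?_, ?_, ?_⟩
  · simp only [Complex.conj_re, Complex.conj_im] at h0
    linarith
  · rw [← h.energy, RCLike.norm_conj, RCLike.norm_conj]
    simp only [Complex.conj_re, Complex.conj_im]
    ring
  · rw [hγ', hVE, Real.cos_two_pi_sub, Real.sin_two_pi_sub]
    linear_combination -h.snell₀
  · rw [hγ', hVE, Real.cos_two_pi_sub, Real.sin_two_pi_sub]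
    linear_combination -h.snell₁

/-- Rotation of a link by a half turn. -/
lemma IsLink.rotate {ξ₀ ξ₁ : ℝ} {A B : ℂ} {η : ℝ} (h : P.IsLink ξ₀ ξ₁ A B η) {a c : ℝ}
    (ha : Real.cos a = -Real.cos ξ₀ ∧ Real.sin a = -Real.sin ξ₀)
    (hc : Real.cos c = -Real.cos ξ₁ ∧ Real.sin c = -Real.sin ξ₁) :
    P.IsLink a c (Complex.I * A) (Complex.I * B) η := by
  have hγ : ∀ x ξ, Real.cos x = -Real.cos ξ ∧ Real.sin x = -Real.sin ξ → P.γ x = -P.γ ξ :=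
    fun x ξ hx => by apply Complex.ext <;> simp [γ, hx.1, hx.2]
  have hγ' : ∀ x ξ, Real.cos x = -Real.cos ξ ∧ Real.sin x = -Real.sin ξ →
      inner ℝ (Complex.I * A * (Complex.I * B)) (P.γ' x) = inner ℝ (A * B) (P.γ' ξ) :=
    fun x ξ hx => by
      simp only [inner_eq_re_im, γ', hx.1, hx.2, Complex.mul_re, Complex.mul_im, Complex.I_re,
        Complex.I_im]
      ring
  have hVE : ∀ x ξ, Real.cos x = -Real.cos ξ ∧ Real.sin x = -Real.sin ξ →
      P.VE (P.γ x) = P.VE (P.γ ξ) := fun x ξ hx => by rw [hγ x ξ hx, VE, VE, norm_neg]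
  refine ⟨?_, ?_, h.η_pos, h.η_lt, fun h0 => h.im_ne ?_, ?_, ?_, ?_⟩
  · rw [hγ _ _ ha, ← h.sqA, mul_pow, Complex.I_sq, neg_one_mul]
  · rw [hγ _ _ hc, ← h.sqB, mul_pow, Complex.I_sq, neg_one_mul]
  · simp only [Complex.mul_re, Complex.mul_im, Complex.I_re, Complex.I_im] at h0
    linarith
  · rw [← h.energy]
    simp only [norm_mul, Complex.norm_I, Complex.mul_re, Complex.mul_im, Complex.I_re,
      Complex.I_im]
    ring
  · rw [hγ' _ _ ha, hVE _ _ ha, ha.1, ha.2]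
    linear_combination h.snell₀
  · rw [hγ' _ _ hc, hVE _ _ hc, hc.1, hc.2]
    linear_combination h.snell₁

end GalaxyParams

/-! ### The principal complex square root and its smoothness. -/

/-- Real part of the principal square root of `x + i y`. -/
def sqrtRe (x y : ℝ) : ℝ := √((√(x ^ 2 + y ^ 2) + x) / 2)

/-- Imaginary part of the principal square root of `x + i y`. -/
def sqrtIm (x y : ℝ) : ℝ := y / (2 * sqrtRe x y)

/-- The hypothesis, used throughout this part, says that x + iy lies off the branch cut, the closed
negative real axis. Near (1, 0) it follows from x > 0 and near (0, b) from y > 0. -/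
lemma sqrtRe_pos {x y : ℝ} (h : 0 < √(x ^ 2 + y ^ 2) + x) : 0 < sqrtRe x y :=
  Real.sqrt_pos.2 (by positivity)

lemma sqrt_add_pos_of_pos_left {x y : ℝ} (hx : 0 < x) : 0 < √(x ^ 2 + y ^ 2) + x :=
  add_pos_of_nonneg_of_pos (Real.sqrt_nonneg _) hx

lemma sqrt_add_pos_of_pos_right {x y : ℝ} (hy : 0 < y) : 0 < √(x ^ 2 + y ^ 2) + x := by
  have h : |x| < √(x ^ 2 + y ^ 2) := by
    rw [← Real.sqrt_sq_eq_abs]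
    exact Real.sqrt_lt_sqrt (sq_nonneg _) (by nlinarith)
  have := neg_abs_le x
  linarith

lemma sqrtRe_sq_sub_sqrtIm_sq {x y : ℝ} (h : 0 < √(x ^ 2 + y ^ 2) + x) :
    sqrtRe x y ^ 2 - sqrtIm x y ^ 2 = x := by
  have h1 : sqrtRe x y ^ 2 = (√(x ^ 2 + y ^ 2) + x) / 2 := Real.sq_sqrt (by positivity)
  have h2 : √(x ^ 2 + y ^ 2) ^ 2 = x ^ 2 + y ^ 2 := Real.sq_sqrt (by positivity)
  have h3 : sqrtIm x y ^ 2 = y ^ 2 / (2 * (√(x ^ 2 + y ^ 2) + x)) := by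
    rw [sqrtIm, div_pow, mul_pow, h1]
    congr 1
    ring
  rw [h1, h3]
  field_simp
  linear_combination h2

lemma two_mul_sqrtRe_mul_sqrtIm {x y : ℝ} (h : 0 < √(x ^ 2 + y ^ 2) + x) :
    2 * (sqrtRe x y * sqrtIm x y) = y := by
  have := sqrtRe_pos h
  rw [sqrtIm]
  field_simp

lemma sqrt_complex_sq {x y : ℝ} (h : 0 < √(x ^ 2 + y ^ 2) + x) :
    (⟨sqrtRe x y, sqrtIm x y⟩ : ℂ) ^ 2 = ⟨x, y⟩ := by
  have h1 := sqrtRe_sq_sub_sqrtIm_sq h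
  have h2 := two_mul_sqrtRe_mul_sqrtIm h
  apply Complex.ext
  · simp only [pow_two, Complex.mul_re]
    linarith
  · simp only [pow_two, Complex.mul_im]
    linarith

section smooth

variable {F : Type*} [NormedAddCommGroup F] [NormedSpace ℝ F] {f g : F → ℝ} {v : F}

lemma contDiffAt_sqrt_sq_add_sq (hf : ContDiffAt ℝ 1 f v) (hg : ContDiffAt ℝ 1 g v)
    (h : 0 < √(f v ^ 2 + g v ^ 2) + f v) :
    ContDiffAt ℝ 1 (fun v => √(f v ^ 2 + g v ^ 2)) v := by
  refine ((hf.pow 2).add (hg.pow 2)).sqrt fun h0 => ?_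
  have h0' : f v ^ 2 + g v ^ 2 = 0 := h0
  have : f v = 0 := by nlinarith [sq_nonneg (f v), sq_nonneg (g v)]
  rw [h0', this] at h
  simp at h

lemma contDiffAt_sqrtRe (hf : ContDiffAt ℝ 1 f v) (hg : ContDiffAt ℝ 1 g v)
    (h : 0 < √(f v ^ 2 + g v ^ 2) + f v) :
    ContDiffAt ℝ 1 (fun v => sqrtRe (f v) (g v)) v :=
  (((contDiffAt_sqrt_sq_add_sq hf hg h).add hf).div_const 2).sqrt (by positivity)

lemma contDiffAt_sqrtIm (hf : ContDiffAt ℝ 1 f v) (hg : ContDiffAt ℝ 1 g v)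
    (h : 0 < √(f v ^ 2 + g v ^ 2) + f v) :
    ContDiffAt ℝ 1 (fun v => sqrtIm (f v) (g v)) v :=
  hg.div (contDiffAt_const.mul (contDiffAt_sqrtRe hf hg h))
    (mul_ne_zero two_ne_zero (sqrtRe_pos h).ne')

end smooth

/-! ### The rescaled system near infinite h. -/

/-- The rescaled energy equation of a link with ends `(m₀ + i n₀)²` and `(m₁ + i n₁)²`. -/
def linkEnergy (μ ε k r₀ r₁ m₀ n₀ m₁ n₁ : ℝ) : ℝ :=
  k * (ε ^ 2 * k * (r₀ + r₁) + 2 * √(1 + (ε ^ 2 * k) ^ 2) * (m₀ * m₁ + n₀ * n₁)) - μ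

/-- The rescaled refraction equation at a point `(c, b s)` with `s c = ε² p`. -/
def linkSnell (E ω b ε k s c p r m₀ n₀ m₁ n₁ : ℝ) : ℝ :=
  k * ((m₀ * m₁ - n₀ * n₁) * s - (m₀ * n₁ + n₀ * m₁) * (b * c)) +
    (1 - b ^ 2) * p * (√(1 + (ε ^ 2 * k) ^ 2) - ε * √(E - ω ^ 2 / 2 * r ^ 2))

/-- The rescaled system for a link from near `(1, 0)` to near `(0, b)`, in the unknowns
`(ε, k, X, Y)` with `ε² = 1 / (E + h)`, `η = ε² k`, `sin ξ₀ = ε² X`, `cos ξ₁ = ε² Y`. -/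
def linkMap (E ω μ b : ℝ) (v : ℝ × ℝ × ℝ × ℝ) : ℝ × ℝ × ℝ × ℝ :=
  let ε := v.1
  let k := v.2.1
  let X := v.2.2.1
  let Y := v.2.2.2
  let s₀ := ε ^ 2 * X
  let c₀ := √(1 - (ε ^ 2 * X) ^ 2)
  let c₁ := ε ^ 2 * Y
  let s₁ := √(1 - (ε ^ 2 * Y) ^ 2)
  let r₀ := √(c₀ ^ 2 + (b * s₀) ^ 2)
  let r₁ := √(c₁ ^ 2 + (b * s₁) ^ 2)
  let m₀ := sqrtRe c₀ (b * s₀)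
  let n₀ := sqrtIm c₀ (b * s₀)
  let m₁ := sqrtRe c₁ (b * s₁)
  let n₁ := sqrtIm c₁ (b * s₁)
  (ε, linkEnergy μ ε k r₀ r₁ m₀ n₀ m₁ n₁, linkSnell E ω b ε k s₀ c₀ (X * c₀) r₀ m₀ n₀ m₁ n₁,
    linkSnell E ω b ε k s₁ c₁ (Y * s₁) r₁ m₀ n₀ m₁ n₁)

/-- At ε = 0 the ends sit at the vertices, with square roots 1 and √(b/2)(1 + i), and the system is
affine and triangular in k, X, Y. -/
lemma linkMap_zero (E ω μ : ℝ) {b : ℝ} (hb : 0 < b) (k X Y : ℝ) :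
    linkMap E ω μ b (0, k, X, Y) = (0, 2 * √(b / 2) * k - μ,
      (1 - b ^ 2) * X - k * √(b / 2) * b, (1 - b ^ 2) * Y + k * √(b / 2)) := by
  have hd : 0 < √(b / 2) := by positivity
  have hd2 : √(b / 2) ^ 2 = b / 2 := Real.sq_sqrt (by positivity)
  have h1 : sqrtRe 1 0 = 1 := by norm_num [sqrtRe]
  have h2 : sqrtIm 1 0 = 0 := by simp [sqrtIm]
  have h3 : sqrtRe 0 b = √(b / 2) := by simp [sqrtRe, Real.sqrt_sq hb.le]
  have h4 : sqrtIm 0 b = √(b / 2) := by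
    rw [sqrtIm, h3]; field_simp; linarith
  simp only [linkMap, linkEnergy, linkSnell]
  norm_num [h1, h2, h3, h4]
  refine ⟨?_, ?_, ?_⟩ <;> ring

lemma contDiffAt_linkMap {E ω : ℝ} (μ : ℝ) {b : ℝ} (hb0 : 0 < b) (hb1 : b ≤ 1)
    (hHill : ω ^ 2 < 2 * E) (k X Y : ℝ) :
    ContDiffAt ℝ 1 (linkMap E ω μ b) (0, k, X, Y) := by
  set v₀ : ℝ × ℝ × ℝ × ℝ := (0, k, X, Y) with hv₀
  have hε : ContDiffAt ℝ 1 (fun v : ℝ × ℝ × ℝ × ℝ => v.1) v₀ := contDiffAt_fst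
  have hk : ContDiffAt ℝ 1 (fun v : ℝ × ℝ × ℝ × ℝ => v.2.1) v₀ := by fun_prop
  have hX : ContDiffAt ℝ 1 (fun v : ℝ × ℝ × ℝ × ℝ => v.2.2.1) v₀ := by fun_prop
  have hY : ContDiffAt ℝ 1 (fun v : ℝ × ℝ × ℝ × ℝ => v.2.2.2) v₀ := by fun_prop
  have hs₀ : ContDiffAt ℝ 1 (fun v : ℝ × ℝ × ℝ × ℝ => v.1 ^ 2 * v.2.2.1) v₀ := by fun_prop
  have hc₁ : ContDiffAt ℝ 1 (fun v : ℝ × ℝ × ℝ × ℝ => v.1 ^ 2 * v.2.2.2) v₀ := by fun_prop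
  have hc₀ : ContDiffAt ℝ 1 (fun v : ℝ × ℝ × ℝ × ℝ => √(1 - (v.1 ^ 2 * v.2.2.1) ^ 2)) v₀ :=
    (contDiffAt_const.sub (hs₀.pow 2)).sqrt (by simp [hv₀])
  have hs₁ : ContDiffAt ℝ 1 (fun v : ℝ × ℝ × ℝ × ℝ => √(1 - (v.1 ^ 2 * v.2.2.2) ^ 2)) v₀ :=
    (contDiffAt_const.sub (hc₁.pow 2)).sqrt (by simp [hv₀])
  have hbs₀ := (contDiffAt_const (c := b)).mul hs₀
  have hbs₁ := (contDiffAt_const (c := b)).mul hs₁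
  have p₀ := sqrt_add_pos_of_pos_left (y := b * (v₀.1 ^ 2 * v₀.2.2.1))
    (show 0 < √(1 - (v₀.1 ^ 2 * v₀.2.2.1) ^ 2) by simp [hv₀])
  have p₁ := sqrt_add_pos_of_pos_right (x := v₀.1 ^ 2 * v₀.2.2.2)
    (show 0 < b * √(1 - (v₀.1 ^ 2 * v₀.2.2.2) ^ 2) by simp [hv₀, hb0])
  have hr₀ := contDiffAt_sqrt_sq_add_sq hc₀ hbs₀ p₀
  have hr₁ := contDiffAt_sqrt_sq_add_sq hc₁ hbs₁ p₁
  have hm₀ := contDiffAt_sqrtRe hc₀ hbs₀ p₀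
  have hn₀ := contDiffAt_sqrtIm hc₀ hbs₀ p₀
  have hm₁ := contDiffAt_sqrtRe hc₁ hbs₁ p₁
  have hn₁ := contDiffAt_sqrtIm hc₁ hbs₁ p₁
  have hκ : ContDiffAt ℝ 1 (fun v : ℝ × ℝ × ℝ × ℝ => √(1 + (v.1 ^ 2 * v.2.1) ^ 2)) v₀ :=
    (contDiffAt_const.add (((hε.pow 2).mul hk).pow 2)).sqrt (by positivity)
  have hV₀ := ((contDiffAt_const (c := E)).sub
    ((contDiffAt_const (c := ω ^ 2 / 2)).mul (hr₀.pow 2))).sqrt (by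
      simp [hv₀]; nlinarith)
  have hV₁ := ((contDiffAt_const (c := E)).sub
    ((contDiffAt_const (c := ω ^ 2 / 2)).mul (hr₁.pow 2))).sqrt (by
      simp [hv₀, Real.sqrt_sq hb0.le]
      have : b ^ 2 ≤ 1 := pow_le_one₀ hb0.le hb1
      have := mul_le_of_le_one_right (sq_nonneg ω) this
      apply ne_of_gt
      linarith)
  refine hε.prodMk (ContDiffAt.prodMk ?_ (ContDiffAt.prodMk ?_ ?_))
  · simp only [linkEnergy]
    exact (hk.mul ((((hε.pow 2).mul hk).mul (hr₀.add hr₁)).add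
      ((contDiffAt_const.mul hκ).mul ((hm₀.mul hm₁).add (hn₀.mul hn₁))))).sub contDiffAt_const
  · simp only [linkSnell]
    exact (hk.mul ((((hm₀.mul hm₁).sub (hn₀.mul hn₁)).mul hs₀).sub
      (((hm₀.mul hn₁).add (hn₀.mul hm₁)).mul (contDiffAt_const.mul hc₀)))).add
      ((contDiffAt_const.mul (hX.mul hc₀)).mul (hκ.sub (hε.mul hV₀)))
  · simp only [linkSnell]
    exact (hk.mul ((((hm₀.mul hm₁).sub (hn₀.mul hn₁)).mul hs₁).sub
      (((hm₀.mul hn₁).add (hn₀.mul hm₁)).mul (contDiffAt_const.mul hc₁)))).add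
      ((contDiffAt_const.mul (hY.mul hs₁)).mul (hκ.sub (hε.mul hV₁)))

/-- The derivative is onto: its first component is that of ε, and on the hyperplane of vanishing
ε-increment it is triangular with nonzero diagonal entries 2√(b/2), 1 - b², 1 - b². Hence the map is
open at the point. -/
lemma map_nhds_linkMap {E ω : ℝ} (μ : ℝ) {b : ℝ} (hb0 : 0 < b) (hb1 : b < 1)
    (hHill : ω ^ 2 < 2 * E) (k X Y : ℝ) :
    map (linkMap E ω μ b) (𝓝 (0, k, X, Y)) = 𝓝 (linkMap E ω μ b (0, k, X, Y)) := by
  have hst := (contDiffAt_linkMap μ hb0 hb1.le hHill k X Y).hasStrictFDerivAt one_ne_zero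
  set L := fderiv ℝ (linkMap E ω μ b) (0, k, X, Y) with hL
  refine hst.map_nhds_eq_of_surj ?_
  have hd : 0 < √(b / 2) := by positivity
  have hb : 0 < 1 - b ^ 2 := by nlinarith
  have h1 : ∀ w, (L w).1 = w.1 := by
    intro w
    have e1 := hst.hasFDerivAt.fst
    have e2 : HasFDerivAt (fun v => (linkMap E ω μ b v).1)
        (ContinuousLinearMap.fst ℝ ℝ (ℝ × ℝ × ℝ)) (0, k, X, Y) := hasFDerivAt_fst
    exact congrArg (fun T : (ℝ × ℝ × ℝ × ℝ) →L[ℝ] ℝ => T w) (e1.unique e2)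
  have h2 : ∀ a x y, L (0, a, x, y) = (0, 2 * √(b / 2) * a,
      (1 - b ^ 2) * x - a * √(b / 2) * b, (1 - b ^ 2) * y + a * √(b / 2)) := by
    intro a x y
    have hline : HasDerivAt (fun t : ℝ => ((0 : ℝ), k + t * a, X + t * x, Y + t * y))
        (0, a, x, y) 0 := by
      have aux : ∀ p q : ℝ, HasDerivAt (fun t : ℝ => p + t * q) q 0 := fun p q => by
        simpa using ((hasDerivAt_id (0 : ℝ)).mul_const q).const_add p
      exact (hasDerivAt_const _ _).prodMk ((aux _ _).prodMk ((aux _ _).prodMk (aux _ _)))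
    have hf : HasFDerivAt (linkMap E ω μ b) L
        ((fun t : ℝ => ((0 : ℝ), k + t * a, X + t * x, Y + t * y)) 0) := by
      simpa using hst.hasFDerivAt
    have e1 := hf.comp_hasDerivAt 0 hline
    have e2 : HasDerivAt
        (linkMap E ω μ b ∘ fun t : ℝ => ((0 : ℝ), k + t * a, X + t * x, Y + t * y))
        (0, 2 * √(b / 2) * a, (1 - b ^ 2) * x - a * √(b / 2) * b,
          (1 - b ^ 2) * y + a * √(b / 2)) 0 := by
      have : (linkMap E ω μ b ∘ fun t : ℝ => ((0 : ℝ), k + t * a, X + t * x, Y + t * y)) =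
          fun t : ℝ => ((0 : ℝ), (2 * √(b / 2) * k - μ) + t * (2 * √(b / 2) * a),
            ((1 - b ^ 2) * X - k * √(b / 2) * b) + t * ((1 - b ^ 2) * x - a * √(b / 2) * b),
            ((1 - b ^ 2) * Y + k * √(b / 2)) + t * ((1 - b ^ 2) * y + a * √(b / 2))) := by
        funext t
        simp only [Function.comp_apply, linkMap_zero _ _ _ hb0, Prod.mk.injEq, true_and]
        refine ⟨?_, ?_, ?_⟩ <;> ring
      rw [this]
      have aux : ∀ p q : ℝ, HasDerivAt (fun t : ℝ => p + t * q) q 0 := fun p q => by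
        simpa using ((hasDerivAt_id (0 : ℝ)).mul_const q).const_add p
      exact (hasDerivAt_const _ _).prodMk ((aux _ _).prodMk ((aux _ _).prodMk (aux _ _)))
    exact e1.unique e2
  rw [LinearMap.range_eq_top]
  rintro ⟨w₀, w₁, w₂, w₃⟩
  -- The column of ε-derivatives may stay unknown: the triangular block corrects for it.
  obtain ⟨q₁, q₂, q₃, hq⟩ : ∃ q₁ q₂ q₃, L (w₀, 0, 0, 0) = (w₀, q₁, q₂, q₃) :=
    ⟨(L (w₀, 0, 0, 0)).2.1, (L (w₀, 0, 0, 0)).2.2.1, (L (w₀, 0, 0, 0)).2.2.2,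
      Prod.ext (h1 _) rfl⟩
  set a := (w₁ - q₁) / (2 * √(b / 2)) with ha
  refine ⟨(w₀, a, (w₂ - q₂ + a * √(b / 2) * b) / (1 - b ^ 2),
    (w₃ - q₃ - a * √(b / 2)) / (1 - b ^ 2)), ?_⟩
  have hsum : ∀ x y, ((w₀, a, x, y) : ℝ × ℝ × ℝ × ℝ) = (w₀, 0, 0, 0) + (0, a, x, y) := by
    intro x y; simp
  rw [hsum]
  simp only [ContinuousLinearMap.coe_coe]
  rw [map_add, hq, h2]
  have ha' : 2 * √(b / 2) * a = w₁ - q₁ := by rw [ha]; field_simp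
  simp only [Prod.mk_add_mk, Prod.mk.injEq, add_zero, true_and]
  refine ⟨?_, ?_, ?_⟩
  · rw [ha']; ring
  · field_simp; ring
  · field_simp; ring

/-- Small solutions of the rescaled system. -/
lemma eventually_exists_linkMap_eq {E ω μ b : ℝ} (hb0 : 0 < b) (hb1 : b < 1)
    (hHill : ω ^ 2 < 2 * E) (hμ : 0 < μ) :
    ∀ᶠ ε in 𝓝 (0 : ℝ), ∃ k X Y : ℝ, 0 < k ∧ ε ^ 2 * k < b ∧ 0 < X ∧ ε ^ 2 * X < √2 / 2 ∧
      Y < 0 ∧ -(√2 / 2) < ε ^ 2 * Y ∧ linkMap E ω μ b (ε, k, X, Y) = (ε, 0, 0, 0) := by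
  have hd : 0 < √(b / 2) := by positivity
  have hb : 0 < 1 - b ^ 2 := by nlinarith
  have hs2 : 0 < √(2 : ℝ) / 2 := by positivity
  set k := μ / (2 * √(b / 2)) with hk
  have hk0 : 0 < k := by positivity
  set X := k * √(b / 2) * b / (1 - b ^ 2) with hX
  set Y := -(k * √(b / 2)) / (1 - b ^ 2) with hY
  have hX0 : 0 < X := by positivity
  have hY0 : Y < 0 := div_neg_of_neg_of_pos (neg_neg_of_pos (by positivity)) hb
  have hzero : linkMap E ω μ b (0, k, X, Y) = 0 := by
    rw [linkMap_zero _ _ _ hb0]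
    simp only [Prod.mk_eq_zero, true_and]
    refine ⟨?_, ?_, ?_⟩
    · rw [hk]; field_simp; ring
    · rw [hX]; field_simp; ring
    · rw [hY]; field_simp; ring
  have hmap := map_nhds_linkMap (E := E) (ω := ω) μ hb0 hb1 hHill k X Y
  rw [hzero] at hmap
  have hU : ∀ᶠ v : ℝ × ℝ × ℝ × ℝ in 𝓝 (0, k, X, Y), 0 < v.2.1 ∧ v.1 ^ 2 * v.2.1 < b ∧
      0 < v.2.2.1 ∧ v.1 ^ 2 * v.2.2.1 < √2 / 2 ∧ v.2.2.2 < 0 ∧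
      -(√2 / 2) < v.1 ^ 2 * v.2.2.2 := by
    have hlt : ∀ f g : ℝ × ℝ × ℝ × ℝ → ℝ, Continuous f → Continuous g →
        f (0, k, X, Y) < g (0, k, X, Y) → ∀ᶠ v in 𝓝 (0, k, X, Y), f v < g v :=
      fun f g hf hg h => (isOpen_lt hf hg).mem_nhds h
    refine (hlt _ _ (by fun_prop) (by fun_prop) ?_).and
      ((hlt _ _ (by fun_prop) (by fun_prop) ?_).and
      ((hlt _ _ (by fun_prop) (by fun_prop) ?_).and
      ((hlt _ _ (by fun_prop) (by fun_prop) ?_).and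
      ((hlt _ _ (by fun_prop) (by fun_prop) ?_).and
      (hlt _ _ (by fun_prop) (by fun_prop) ?_))))) <;> simp <;> assumption
  -- The image of the set of admissible unknowns is a neighbourhood of 0, so it contains (ε, 0, 0,
  -- 0) for all small ε; as ε is itself a component of the map, the preimage carries the same ε.
  have himg := image_mem_map (m := linkMap E ω μ b) hU
  rw [hmap] at himg
  have hc : Continuous fun ε : ℝ => ((ε, 0, 0, 0) : ℝ × ℝ × ℝ × ℝ) := by fun_prop
  have hev := hc.continuousAt.preimage_mem_nhds (x := (0 : ℝ)) himg
  filter_upwards [hev] with ε hε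
  obtain ⟨⟨ε', k', X', Y'⟩, hv, heq⟩ := hε
  have : ε' = ε := congrArg Prod.fst heq
  subst this
  exact ⟨k', X', Y', hv.1, hv.2.1, hv.2.2.1, hv.2.2.2.1, hv.2.2.2.2.1, hv.2.2.2.2.2, heq⟩

/-! ### From rescaled roots to links for large h. -/

namespace GalaxyParams

/-- The rescaled equations are the link equations divided by ε² (energy) and by √(E + h) ε² = ε
(refraction). -/
lemma isLink_of_linkMap_eq {P : GalaxyParams} (hb0 : 0 < P.b) (hE : 0 < P.E + P.h)
    {ε k X Y : ℝ} (hε : ε = 1 / √(P.E + P.h)) (hk : 0 < k) (hkb : ε ^ 2 * k < P.b) (hX : 0 < X)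
    (hX' : ε ^ 2 * X < √2 / 2) (hY : Y < 0) (hY' : -(√2 / 2) < ε ^ 2 * Y)
    (h : linkMap P.E P.ω P.μ P.b (ε, k, X, Y) = (ε, 0, 0, 0)) :
    ∃ A B, P.IsLink (Real.arcsin (ε ^ 2 * X)) (Real.arccos (ε ^ 2 * Y)) A B (ε ^ 2 * k) := by
  have hen : 0 < √(P.E + P.h) := Real.sqrt_pos.2 hE
  have hε0 : 0 < ε := by rw [hε]; positivity
  have hε1 : √(P.E + P.h) * ε = 1 := by rw [hε]; field_simp
  have hε2 : P.μ / (P.E + P.h) = P.μ * ε ^ 2 := by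
    rw [hε, div_pow, Real.sq_sqrt hE.le]; ring
  have hs2 : √(2 : ℝ) / 2 < 1 := by
    have : √(2 : ℝ) < 2 := by rw [Real.sqrt_lt' two_pos]; norm_num
    linarith
  have hX0 : 0 < ε ^ 2 * X := by positivity
  have hY0 : ε ^ 2 * Y < 0 := mul_neg_of_pos_of_neg (by positivity) hY
  set ξ₀ := Real.arcsin (ε ^ 2 * X) with hξ₀
  set ξ₁ := Real.arccos (ε ^ 2 * Y) with hξ₁
  have hsin₀ : Real.sin ξ₀ = ε ^ 2 * X := Real.sin_arcsin (by linarith) (by linarith)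
  have hcos₀ : Real.cos ξ₀ = √(1 - (ε ^ 2 * X) ^ 2) := Real.cos_arcsin _
  have hcos₁ : Real.cos ξ₁ = ε ^ 2 * Y := Real.cos_arccos (by linarith) (by linarith)
  have hsin₁ : Real.sin ξ₁ = √(1 - (ε ^ 2 * Y) ^ 2) := Real.sin_arccos _
  have hc₀ : 0 < √(1 - (ε ^ 2 * X) ^ 2) := Real.sqrt_pos.2 (by nlinarith)
  have hs₁ : 0 < √(1 - (ε ^ 2 * Y) ^ 2) := Real.sqrt_pos.2 (by nlinarith)
  simp only [linkMap, Prod.mk.injEq, true_and] at h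
  rw [← hcos₀, ← hsin₀, ← hsin₁, ← hcos₁] at h
  rw [← hcos₀] at hc₀
  rw [← hsin₁] at hs₁
  obtain ⟨h1, h2, h3⟩ := h
  have p₀ := sqrt_add_pos_of_pos_left (y := P.b * Real.sin ξ₀) hc₀
  have p₁ := sqrt_add_pos_of_pos_right (x := Real.cos ξ₁) (mul_pos hb0 hs₁)
  have sq₀ := sqrt_complex_sq p₀
  have sq₁ := sqrt_complex_sq p₁
  set m₀ := sqrtRe (Real.cos ξ₀) (P.b * Real.sin ξ₀)
  set n₀ := sqrtIm (Real.cos ξ₀) (P.b * Real.sin ξ₀)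
  set m₁ := sqrtRe (Real.cos ξ₁) (P.b * Real.sin ξ₁)
  set n₁ := sqrtIm (Real.cos ξ₁) (P.b * Real.sin ξ₁)
  have hr : ∀ ξ, √(Real.cos ξ ^ 2 + (P.b * Real.sin ξ) ^ 2) = ‖P.γ ξ‖ := fun ξ => by
    rw [Real.sqrt_eq_iff_mul_self_eq (by positivity) (norm_nonneg _), ← pow_two, norm_γ_sq]
    ring
  rw [hr] at h1 h2 h3
  rw [hr] at h1
  have hA2 : (⟨m₀, n₀⟩ : ℂ) ^ 2 = P.γ ξ₀ := sq₀
  -- The opposite square root is taken at the second end: the energy equation with small η > 0 needs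
  -- A · B < 0. In the limit ζ turns by 3π/4, so the arc swings by 3π/2 around the attracting
  -- centre.
  have hB2 : (-⟨m₁, n₁⟩ : ℂ) ^ 2 = P.γ ξ₁ := by rw [neg_sq]; exact sq₁
  refine ⟨⟨m₀, n₀⟩, -⟨m₁, n₁⟩, hA2, hB2, by positivity, hkb, fun h0 => ?_, ?_, ?_, ?_⟩
  · have a1 := congrArg Complex.re sq₀
    have a2 := congrArg Complex.im sq₀
    have a3 := congrArg Complex.re sq₁
    have a4 := congrArg Complex.im sq₁
    simp only [pow_two, Complex.mul_re, Complex.mul_im] at a1 a2 a3 a4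
    simp only [Complex.neg_re, Complex.neg_im] at h0
    -- The cross product of the squares is twice the dot product times the cross product of the
    -- roots, so its positivity excludes collinear A and B.
    have hpos : 0 < Real.cos ξ₀ * (P.b * Real.sin ξ₁) - P.b * Real.sin ξ₀ * Real.cos ξ₁ := by
      have e1 : 0 < Real.cos ξ₀ * (P.b * Real.sin ξ₁) := by positivity
      have e2 : P.b * Real.sin ξ₀ * Real.cos ξ₁ < 0 := by
        rw [hsin₀, hcos₁]
        exact mul_neg_of_pos_of_neg (by positivity) hY0
      linarith
    rw [← a1, ← a2, ← a3, ← a4] at hpos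
    have : (m₀ * m₀ - n₀ * n₀) * (m₁ * n₁ + n₁ * m₁) - (m₀ * n₀ + n₀ * m₀) *
        (m₁ * m₁ - n₁ * n₁) = 0 := by
      linear_combination (-2 * (m₀ * m₁ + n₀ * n₁)) * h0
    linarith
  · rw [← norm_pow, hA2, ← norm_pow, hB2, hε2]
    simp only [linkEnergy] at h1
    simp only [Complex.neg_re, Complex.neg_im]
    linear_combination ε ^ 2 * h1
  · simp only [linkSnell] at h2
    simp only [inner_eq_re_im, γ', Complex.mul_re, Complex.mul_im, Complex.neg_re,
      Complex.neg_im, VE]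
    rw [hsin₀] at h2 ⊢
    linear_combination (√(P.E + P.h) * ε ^ 2) * h2 +
      (1 - P.b ^ 2) * √(P.E - P.ω ^ 2 / 2 * ‖P.γ ξ₀‖ ^ 2) * (ε ^ 2 * X * Real.cos ξ₀) * hε1
  · simp only [linkSnell] at h3
    simp only [inner_eq_re_im, γ', Complex.mul_re, Complex.mul_im, Complex.neg_re,
      Complex.neg_im, VE]
    rw [hcos₁] at h3 ⊢
    linear_combination (√(P.E + P.h) * ε ^ 2) * h3 +
      (1 - P.b ^ 2) * √(P.E - P.ω ^ 2 / 2 * ‖P.γ ξ₁‖ ^ 2) * (ε ^ 2 * Y * Real.sin ξ₁) * hε1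

end GalaxyParams

/-- Large h means small ε = 1 / √(E + h). The bounds by √2/2 on sin ξ₀ and |cos ξ₁| confine each end
to one octant. -/
lemma exists_link {E ω μ e : ℝ} (hE : 0 < E) (hHill : ω ^ 2 < 2 * E) (hμ : 0 < μ)
    (hb0 : 0 < √(1 - e ^ 2)) (hb1 : √(1 - e ^ 2) < 1) :
    ∃ H : ℝ, 0 < H ∧ ∀ h, H < h → ∃ ξ₀ ξ₁ A B η,
      (GalaxyParams.mk E h μ ω e).IsLink ξ₀ ξ₁ A B η ∧
      ξ₀ ∈ Ioo 0 (Real.pi / 4) ∧ ξ₁ ∈ Ioo (Real.pi / 2) (3 * Real.pi / 4) := by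
  have hlim : Tendsto (fun h : ℝ => 1 / √(E + h)) atTop (𝓝 0) := by
    refine tendsto_const_nhds.div_atTop ?_
    exact Real.tendsto_sqrt_atTop.comp (tendsto_atTop_add_const_left _ _ tendsto_id)
  have hev := hlim.eventually (eventually_exists_linkMap_eq hb0 hb1 hHill hμ)
  obtain ⟨H, hH⟩ := eventually_atTop.1 hev
  refine ⟨max H 1, by positivity, fun h hh => ?_⟩
  have hh0 : 0 < h := zero_lt_one.trans ((le_max_right _ _).trans_lt hh)
  obtain ⟨k, X, Y, hk, hkb, hX, hX', hY, hY', heq⟩ := hH h ((le_max_left _ _).trans hh.le)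
  have hE' : 0 < E + h := by positivity
  obtain ⟨A, B, hl⟩ := GalaxyParams.isLink_of_linkMap_eq (P := GalaxyParams.mk E h μ ω e) hb0 hE'
    rfl hk hkb hX hX' hY hY' heq
  have hπ := Real.pi_pos
  have hε : 0 < (1 / √(E + h)) ^ 2 := by positivity
  have hs2 : √(2 : ℝ) / 2 < 1 := by
    have : √(2 : ℝ) < 2 := by rw [Real.sqrt_lt' two_pos]; norm_num
    linarith
  refine ⟨_, _, A, B, _, hl, ⟨?_, ?_⟩, ?_, ?_⟩
  · exact Real.arcsin_pos.2 (by positivity)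
  · rw [Real.arcsin_lt_iff_lt_sin' ⟨by linarith, by linarith⟩, Real.sin_pi_div_four]
    exact hX'
  · rw [Real.arccos]
    have := Real.arcsin_lt_zero.2 (mul_neg_of_pos_of_neg hε hY)
    linarith
  · rw [Real.arccos]
    have : -(Real.pi / 4) < Real.arcsin ((1 / √(E + h)) ^ 2 * Y) := by
      rw [Real.lt_arcsin_iff_sin_lt' ⟨by linarith, by linarith⟩, Real.sin_neg,
        Real.sin_pi_div_four]
      exact hY'
    linarith

/-! ### Symmetries of the ellipse and the count of orbits. -/

namespace GalaxyParams

lemma radialPoint_pair_ne (P : GalaxyParams) {a b c d : ℝ} (h1 : a ≠ c) (h2 : a ≠ d) :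
    ({P.radialPoint a, P.radialPoint b} : Set (ℝ × ℝ)) ≠ {P.radialPoint c, P.radialPoint d} := by
  intro h
  have : P.radialPoint a ∈ ({P.radialPoint c, P.radialPoint d} : Set (ℝ × ℝ)) :=
    h ▸ mem_insert _ _
  rcases this with h | h
  · exact h1 (congrArg Prod.fst h)
  · exact h2 (congrArg Prod.fst h)

/-- A link with ends in two octants, and its images under the symmetries of the ellipse, give four
periodic orbits. -/
lemma IsLink.four_le_encard {P : GalaxyParams} {ξ₀ ξ₁ : ℝ} {A B : ℂ} {η : ℝ}
    (h : P.IsLink ξ₀ ξ₁ A B η) (hb0 : 0 < P.b) (hb1 : P.b < 1) (hb : 1 ≤ 2 * P.b ^ 2)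
    (hω : 0 < P.ω) (hHill : P.ω ^ 2 < 2 * P.E) (hE : 0 < P.E + P.h) (hμ : 0 < P.μ)
    (h₀ : ξ₀ ∈ Ioo 0 (Real.pi / 4)) (h₁ : ξ₁ ∈ Ioo (Real.pi / 2) (3 * Real.pi / 4)) :
    4 ≤ {O : Set (ℝ × ℝ) | P.IsTwoPeriodicBrakeOrbit O}.encard := by
  obtain ⟨a₀, b₀⟩ := h₀
  obtain ⟨a₁, b₁⟩ := h₁
  have hπ := Real.pi_pos
  have hs₀ : 0 < Real.sin ξ₀ := Real.sin_pos_of_pos_of_lt_pi a₀ (by linarith)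
  have hc₀ : 0 < Real.cos ξ₀ := Real.cos_pos_of_mem_Ioo ⟨by linarith, by linarith⟩
  have hs₁ : 0 < Real.sin ξ₁ := Real.sin_pos_of_pos_of_lt_pi (by linarith) (by linarith)
  have hc₁ : Real.cos ξ₁ < 0 := Real.cos_neg_of_pi_div_two_lt_of_lt a₁ (by linarith)
  have H : ∀ {x y : ℝ} {A B : ℂ} {η : ℝ}, P.IsLink x y A B η → x ∈ Ico 0 (2 * Real.pi) →
      y ∈ Ico 0 (2 * Real.pi) → x ≠ y → Real.sin x * Real.cos x ≠ 0 →
      Real.sin y * Real.cos y ≠ 0 → P.IsTwoPeriodicBrakeOrbit {P.radialPoint x, P.radialPoint y} :=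
    fun hl hx hy hne hsx hsy =>
      hl.isTwoPeriodicBrakeOrbit hb0 hb1 hb hω hHill hE hμ hx hy hne hsx hsy
  have o1 := H h ⟨by linarith, by linarith⟩ ⟨by linarith, by linarith⟩ (by linarith)
    (mul_ne_zero hs₀.ne' hc₀.ne') (mul_ne_zero hs₁.ne' hc₁.ne)
  have o2 := H h.conj ⟨by linarith, by linarith⟩ ⟨by linarith, by linarith⟩
    (fun heq => by linarith)
    (by simpa [Real.sin_two_pi_sub, Real.cos_two_pi_sub] using ⟨hs₀.ne', hc₀.ne'⟩)
    (by simpa [Real.sin_two_pi_sub, Real.cos_two_pi_sub] using ⟨hs₁.ne', hc₁.ne⟩)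
  have o3 := H (h.rotate (a := ξ₀ + Real.pi) (c := ξ₁ + Real.pi)
    ⟨Real.cos_add_pi _, Real.sin_add_pi _⟩ ⟨Real.cos_add_pi _, Real.sin_add_pi _⟩)
    ⟨by linarith, by linarith⟩ ⟨by linarith, by linarith⟩ (fun heq => by linarith)
    (by simpa using ⟨hs₀.ne', hc₀.ne'⟩) (by simpa using ⟨hs₁.ne', hc₁.ne⟩)
  have o4 := H (h.conj.rotate (a := Real.pi - ξ₀) (c := Real.pi - ξ₁)
    ⟨by rw [Real.cos_pi_sub, Real.cos_two_pi_sub],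
      by rw [Real.sin_pi_sub, Real.sin_two_pi_sub, neg_neg]⟩
    ⟨by rw [Real.cos_pi_sub, Real.cos_two_pi_sub],
      by rw [Real.sin_pi_sub, Real.sin_two_pi_sub, neg_neg]⟩)
    ⟨by linarith, by linarith⟩ ⟨by linarith, by linarith⟩ (fun heq => by linarith)
    (by simpa [Real.sin_pi_sub, Real.cos_pi_sub] using ⟨hs₀.ne', hc₀.ne'⟩)
    (by simpa [Real.sin_pi_sub, Real.cos_pi_sub] using ⟨hs₁.ne', hc₁.ne⟩)
  set O₁ : Set (ℝ × ℝ) := {P.radialPoint ξ₀, P.radialPoint ξ₁} with hO₁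
  set O₂ : Set (ℝ × ℝ) :=
    {P.radialPoint (2 * Real.pi - ξ₀), P.radialPoint (2 * Real.pi - ξ₁)} with hO₂
  set O₃ : Set (ℝ × ℝ) := {P.radialPoint (ξ₀ + Real.pi), P.radialPoint (ξ₁ + Real.pi)} with hO₃
  set O₄ : Set (ℝ × ℝ) := {P.radialPoint (Real.pi - ξ₀), P.radialPoint (Real.pi - ξ₁)} with hO₄
  -- The eight end points lie one in each of the eight octants of [0, 2π), so the four pairs are
  -- disjoint.
  have n12 : O₁ ≠ O₂ := P.radialPoint_pair_ne (fun h => by linarith) (fun h => by linarith)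
  have n13 : O₁ ≠ O₃ := P.radialPoint_pair_ne (fun h => by linarith) (fun h => by linarith)
  have n14 : O₁ ≠ O₄ := P.radialPoint_pair_ne (fun h => by linarith) (fun h => by linarith)
  have n23 : O₂ ≠ O₃ := P.radialPoint_pair_ne (fun h => by linarith) (fun h => by linarith)
  have n24 : O₂ ≠ O₄ := P.radialPoint_pair_ne (fun h => by linarith) (fun h => by linarith)
  have n34 : O₃ ≠ O₄ := P.radialPoint_pair_ne (fun h => by linarith) (fun h => by linarith)
  have hcard : ({O₁, O₂, O₃, O₄} : Set (Set (ℝ × ℝ))).encard = 4 := by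
    rw [encard_insert_of_notMem (by simp [n12, n13, n14]),
      encard_insert_of_notMem (by simp [n23, n24]), encard_pair n34]
    norm_num
  rw [← hcard]
  refine encard_le_encard ?_
  rintro O (rfl | rfl | rfl | rfl)
  exacts [o1, o2, o3, o4]

end GalaxyParams

theorem mainTheorem2 (E ω e : ℝ) (hE : 0 < E) (hω : 0 < ω) (hHill : ω ^ 2 < 2 * E)
    (he : e ∈ Set.Ioo (0 : ℝ) (1 / √2)) :
    0 < muBar E ω e ∧
    ∀ μ : ℝ, muBar E ω e < μ →
      ∃ hbar : ℝ, 0 < hbar ∧ ∀ h : ℝ, hbar < h →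
        4 ≤ {O : Set (ℝ × ℝ) |
              (GalaxyParams.mk E h μ ω e).IsTwoPeriodicBrakeOrbit O}.encard := by
  obtain ⟨he0, he1⟩ := he
  have he2 : e ^ 2 < 1 / 2 := by
    have := pow_lt_pow_left₀ he1 he0.le two_ne_zero
    rwa [div_pow, one_pow, Real.sq_sqrt zero_le_two] at this
  have hb0 : 0 < √(1 - e ^ 2) := Real.sqrt_pos.2 (by linarith)
  have hb1 : √(1 - e ^ 2) < 1 := by
    rw [Real.sqrt_lt' one_pos]
    nlinarith
  have hb2 : √(1 - e ^ 2) ^ 2 = 1 - e ^ 2 := Real.sq_sqrt (by linarith)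
  have hmu : 0 < muBar E ω e := by
    have h1 : 0 < 2 * E - e ^ 2 * ω ^ 2 := by nlinarith [sq_nonneg ω]
    have h2 : 0 < (2 * e ^ 2 - 1) ^ 2 := by
      apply sq_pos_of_neg
      linarith
    unfold muBar
    positivity
  refine ⟨hmu, fun μ hμ => ?_⟩
  -- Positivity of μ gives k > 0 in the limit system.
  have hμ0 := hmu.trans hμ
  obtain ⟨H, hH0, hH⟩ := exists_link hE hHill hμ0 hb0 hb1
  refine ⟨H, hH0, fun h hh => ?_⟩
  obtain ⟨ξ₀, ξ₁, A, B, η, hl, h₀, h₁⟩ := hH h hh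
  -- The convexity condition 1 ≤ 2b² is e² ≤ 1/2.
  exact hl.four_le_encard hb0 hb1 (by simp only [GalaxyParams.b]; linarith) hω hHill
    (add_pos hE (hH0.trans hh)) hμ0 h₀ h₁

end
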